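/- **Setting.** Let $k$ be a field, $Q$ a finite quiver, $R=kQ$ its path algebra (paths are composed from left to right), $J\subseteq R$ the two-sided ideal generated by the arrows, $I\subseteq J^2$ a two-sided ideal, $\Lambda=R/I$ and $\mathfrak r=J/I$. Modules are right modules. Assume that $\Lambda$ is a Koszul algebra, i.e. $I$ is homogeneous for path length and the graded right module $\Lambda/\mathfrak r=\Lambda_0$ has a graded projective resolution whose $n$-th term is generated in degree $n$ for every $n\ge 0$. An element $x\in R$ is uniform if $x\neq 0$ and $x=uxv$ for vertices $u,v$; then $\mathfrak t(x):=v$. Let $\{f^n_i\}_{i=0}^{t_n}$ ($n\ge 0$, $t_n\ge -1$) be uniform, length-homogeneous elements of $R$ that define a minimal projective resolution $(\mathbb F,e)$ of $\Lambda/\mathfrak r$. This means: each sum $\sum_i f^n_iR$ is direct, $\coprod_i f^0_iR=R$, $\coprod_i f^{n+1}_iR\subseteq\coprod_i f^n_iR$, and the modules $F^n=\coprod_i f^n_iR/\coprod_i f^n_iI$ with the maps $e^{n+1}\colon F^{n+1}\to F^n$ induced by these inclusions and the natural map $F^0=R/I\to\Lambda/\mathfrak r$ form a projective resolution of $\Lambda/\mathfrak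 r$ with $e^{n+1}(F^{n+1})\subseteq F^n\mathfrak r$. Write $\overline{f^n_i}$ for the class of $f^n_i$ in $F^n$. **Theorem.** 1. There are scalars $c_{pq}(n,i,r)\in k$ ($n\ge 0$, $0\le i\le t_n$, $0\le r\le n$, $0\le p\le t_r$, $0\le q\le t_{n-r}$) such that $$f^n_i=\sum_{p=0}^{t_r}\sum_{q=0}^{t_{n-r}}c_{pq}(n,i,r)\,f^r_pf^{n-r}_q\qquad(\ast)$$ for all $n,i,r$, and $c_{pq}(n,i,r)=0$ whenever $f^r_pf^{n-r}_q=0$. 2. For all $n\ge 0$ and $0\le i\le t_n$ there is a unique $\Lambda$-homomorphism $\widehat f^n_i\colon F^n\to\Lambda/\mathfrak r$ with $\widehat f^n_i(\overline{f^n_j})=\delta_{ij}\,\mathfrak t(f^n_i)$ for all $j$, and $\{\widehat f^n_i\}_{i=0}^{t_n}$ represents a $k$-basis of $\operatorname{Ext}^n_\Lambda(\Lambda/\mathfrak r,\Lambda/\mathfrak r)$. 3. For all scalars $c_{pq}(n,i,r)$ as in 1, all $m,n\ge 0$, $0\le i\le t_m$ and $0\le j\le t_n$, the product in $\operatorname{Ext}^*_\Lambda(\Lambda/\mathfrak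 r,\Lambda/\mathfrak r)$ is $$\widehat f^m_i\,\widehat f^n_j=\sum_{l=0}^{t_{m+n}}c_{ji}(m+n,l,n)\,\widehat f^{m+n}_l .$$ Here, for homomorphisms $\alpha\colon F^m\to\Lambda/\mathfrak r$ and $\beta\colon F^n\to\Lambda/\mathfrak r$, the product $\alpha\beta$ is the Yoneda product represented by $\alpha g_m$, where $g_r\colon F^{n+r}\to F^r$ ($r\ge 0$) are homomorphisms with $g_re^{n+r+1}=e^{r+1}g_{r+1}$ that lift $\beta$. -/

import Mathlib

open CategoryTheory MulOpposite

universe u v w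

noncomputable section

namespace KoszulStructure

/-! ### Path algebras -/

/-- All (directed) paths of a quiver, including the trivial path at each vertex. -/
abbrev AnyPath (V : Type v) [Quiver.{w} V] : Type (max v w) :=
  Σ a b : V, Quiver.Path a b

/-- The path algebra `kQ`: the vector space on all paths. -/
def PathAlgebra (k : Type u) [Field k] (V : Type v) [Quiver.{w} V] : Type (max u v w) :=
  AnyPath V →₀ k

section PathAlgebra

variable {k : Type u} [Field k] {V : Type v} [Quiver.{w} V]

instance : AddCommGroup (PathAlgebra k V) :=
  inferInstanceAs (AddCommGroup (AnyPath V →₀ k))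

instance : Module k (PathAlgebra k V) :=
  inferInstanceAs (Module k (AnyPath V →₀ k))

/-- The basis element of `kQ` given by a path. -/
def ofPath {a b : V} (p : Quiver.Path a b) : PathAlgebra k V :=
  Finsupp.single (⟨a, b, p⟩ : AnyPath V) (1 : k)

open Classical in
/-- The product of two paths: the path "first `p`, then `q`" if `p` ends where `q` starts,
and `0` otherwise. -/
def pathMul (p q : AnyPath V) : PathAlgebra k V :=
  if h : p.2.1 = q.1 then ofPath (p.2.2.comp (q.2.2.cast h.symm rfl)) else 0

/-- The bilinear extension of the product of paths. -/
def mulBilin : PathAlgebra k V →ₗ[k] PathAlgebra k V →ₗ[k] PathAlgebra k V :=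
  Finsupp.linearCombination k
    (fun p : AnyPath V => (Finsupp.linearCombination k
      (fun q : AnyPath V => (pathMul p q : PathAlgebra k V)) :
        PathAlgebra k V →ₗ[k] PathAlgebra k V))

instance : Mul (PathAlgebra k V) := ⟨fun x y => mulBilin x y⟩

/-- The vertex `v`, as an idempotent of the path algebra. -/
def vertex (v : V) : PathAlgebra k V := ofPath (Quiver.Path.nil : Quiver.Path v v)

instance [Fintype V] : One (PathAlgebra k V) := ⟨∑ v : V, vertex v⟩

theorem mul_eq_mulBilin (x y : PathAlgebra k V) : x * y = mulBilin x y := rfl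

theorem mulBilin_ofPath (p q : AnyPath V) :
    mulBilin (ofPath p.2.2 : PathAlgebra k V) (ofPath q.2.2) = pathMul p q := by
  have h1 : mulBilin (ofPath p.2.2 : PathAlgebra k V) = (Finsupp.linearCombination k
      (fun q : AnyPath V => (pathMul p q : PathAlgebra k V)) :
        PathAlgebra k V →ₗ[k] PathAlgebra k V) := by
    refine (Finsupp.linearCombination_single k (1 : k) p).trans ?_
    exact one_smul k _
  rw [h1]
  refine (Finsupp.linearCombination_single k (1 : k) q).trans ?_
  exact one_smul k _

theorem ofPath_mul_ofPath {a b c : V} (p : Quiver.Path a b) (q : Quiver.Path b c) :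
    (ofPath p * ofPath q : PathAlgebra k V) = ofPath (p.comp q) := by
  have h := mulBilin_ofPath (k := k) (⟨a, b, p⟩ : AnyPath V) ⟨b, c, q⟩
  rw [mul_eq_mulBilin]
  refine h.trans ?_
  simp [pathMul]

theorem ofPath_mul_ofPath_of_ne {a b c d : V} (p : Quiver.Path a b) (q : Quiver.Path c d)
    (hbc : b ≠ c) : (ofPath p * ofPath q : PathAlgebra k V) = 0 := by
  have h := mulBilin_ofPath (k := k) (⟨a, b, p⟩ : AnyPath V) ⟨c, d, q⟩
  rw [mul_eq_mulBilin]
  refine h.trans ?_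
  simp [pathMul, hbc]

theorem path_induction {P : PathAlgebra k V → Prop} (x : PathAlgebra k V) (zero : P 0)
    (add : ∀ x y, P x → P y → P (x + y))
    (smul : ∀ (c : k) (a b : V) (p : Quiver.Path a b), P (c • ofPath p)) : P x := by
  refine Finsupp.induction_linear (motive := P) x zero add ?_
  rintro ⟨a, b, p⟩ c
  have h : (Finsupp.single (⟨a, b, p⟩ : AnyPath V) c : AnyPath V →₀ k) =
      c • Finsupp.single (⟨a, b, p⟩ : AnyPath V) 1 := by simp
  rw [h]
  exact smul c a b p

theorem add_mul_aux (x y z : PathAlgebra k V) : (x + y) * z = x * z + y * z := by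
  simp [mul_eq_mulBilin]

theorem mul_add_aux (x y z : PathAlgebra k V) : x * (y + z) = x * y + x * z := by
  simp [mul_eq_mulBilin]

theorem smul_mul_aux (c : k) (x y : PathAlgebra k V) : (c • x) * y = c • (x * y) := by
  simp [mul_eq_mulBilin]

theorem mul_smul_aux (c : k) (x y : PathAlgebra k V) : x * (c • y) = c • (x * y) := by
  simp [mul_eq_mulBilin]

theorem zero_mul_aux (x : PathAlgebra k V) : 0 * x = 0 := by
  simp [mul_eq_mulBilin]

theorem mul_zero_aux (x : PathAlgebra k V) : x * 0 = 0 := by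
  simp [mul_eq_mulBilin]

theorem mul_assoc_aux (x y z : PathAlgebra k V) : x * y * z = x * (y * z) := by
  induction x using path_induction with
  | zero => simp only [zero_mul_aux]
  | add x x' hx hx' => simp only [add_mul_aux, hx, hx']
  | smul c a b p =>
    simp only [smul_mul_aux]
    congr 1
    induction y using path_induction with
    | zero => simp only [zero_mul_aux, mul_zero_aux]
    | add y y' hy hy' => simp only [add_mul_aux, mul_add_aux, hy, hy']
    | smul c a' b' q =>
      simp only [smul_mul_aux, mul_smul_aux]
      congr 1
      induction z using path_induction with
      | zero => simp only [mul_zero_aux]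
      | add z z' hz hz' => simp only [mul_add_aux, hz, hz']
      | smul c a'' b'' r =>
        simp only [mul_smul_aux]
        congr 1
        by_cases h : b = a'
        · subst h
          by_cases h' : b' = a''
          · subst h'
            simp [ofPath_mul_ofPath]
          · simp [ofPath_mul_ofPath, ofPath_mul_ofPath_of_ne _ _ h', mul_zero_aux]
        · by_cases h' : b' = a''
          · subst h'
            simp [ofPath_mul_ofPath, ofPath_mul_ofPath_of_ne _ _ h, zero_mul_aux]
          · simp [ofPath_mul_ofPath_of_ne _ _ h, ofPath_mul_ofPath_of_ne _ _ h', zero_mul_aux,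
              mul_zero_aux]

variable [Fintype V]

theorem one_mul_aux (x : PathAlgebra k V) : 1 * x = x := by
  change mulBilin (∑ v : V, vertex v) x = x
  rw [map_sum, LinearMap.sum_apply]
  simp only [← mul_eq_mulBilin]
  induction x using path_induction with
  | zero => simp [mul_zero_aux]
  | add x y hx hy => simp only [mul_add_aux, Finset.sum_add_distrib, hx, hy]
  | smul c a b p =>
    simp only [mul_smul_aux, ← Finset.smul_sum]
    congr 1
    rw [Finset.sum_eq_single a]
    · simp [vertex, ofPath_mul_ofPath]
    · intro v _ hv
      exact ofPath_mul_ofPath_of_ne _ _ hv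
    · simp

theorem mul_one_aux (x : PathAlgebra k V) : x * 1 = x := by
  change mulBilin x (∑ v : V, vertex v) = x
  rw [map_sum]
  simp only [← mul_eq_mulBilin]
  induction x using path_induction with
  | zero => simp [zero_mul_aux]
  | add x y hx hy => simp only [add_mul_aux, Finset.sum_add_distrib, hx, hy]
  | smul c a b p =>
    simp only [smul_mul_aux, ← Finset.smul_sum]
    congr 1
    rw [Finset.sum_eq_single b]
    · simp [vertex, ofPath_mul_ofPath]
    · intro v _ hv
      exact ofPath_mul_ofPath_of_ne _ _ hv.symm
    · simp

instance : Ring (PathAlgebra k V) where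
  __ := (inferInstance : AddCommGroup (PathAlgebra k V))
  left_distrib := mul_add_aux
  right_distrib := add_mul_aux
  zero_mul := zero_mul_aux
  mul_zero := mul_zero_aux
  mul_assoc := mul_assoc_aux
  one_mul := one_mul_aux
  mul_one := mul_one_aux

instance : Algebra k (PathAlgebra k V) :=
  Algebra.ofModule smul_mul_aux (fun c x y => mul_smul_aux c x y)

variable (k V) in
/-- The two-sided ideal `J` of `kQ` generated by the arrows. -/
def arrowIdeal : Ideal (PathAlgebra k V) :=
  (TwoSidedIdeal.span
    {x : PathAlgebra k V | ∃ (a b : V) (e : a ⟶ b), x = ofPath e.toPath}).asIdeal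

instance : (arrowIdeal k V).IsTwoSided := by
  unfold arrowIdeal
  infer_instance

variable (k V) in
/-- The span of the paths of length `d`. -/
def lengthPart (d : ℕ) : Submodule k (PathAlgebra k V) :=
  Submodule.span k {x | ∃ (a b : V) (p : Quiver.Path a b), p.length = d ∧ x = ofPath p}

/-- `x` is a linear combination of paths of one and the same length. -/
def IsLengthHomogeneous (x : PathAlgebra k V) : Prop :=
  ∃ d, x ∈ lengthPart k V d

/-- `x` is uniform: it is non-zero and `x = u x v` for some vertices `u` and `v`. -/
def IsUniform (x : PathAlgebra k V) : Prop :=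
  x ≠ 0 ∧ ∃ u v : V, x = vertex u * x * vertex v

/-- The vertex `v` with `x = x v`, for a uniform element `x`. -/
def IsUniform.terminus {x : PathAlgebra k V} (hx : IsUniform x) : V :=
  hx.2.choose_spec.choose

end PathAlgebra

/-! ### The product on `Ext` -/

section YonedaProduct

variable {C : Type u} [Category.{v} C] [Abelian C] [HasExt.{w} C] {X : C}

/-- The product `a b` of `a` in `Extᵐ(X, X)` and `b` in `Extⁿ(X, X)`: first `b`, then `a`.
If `P` is a projective resolution of `X` and `a`, `b` are represented by cocycles `α : Pᵐ → X` and
`β : Pⁿ → X`, then `a b` is represented by `α g_m`, where the maps `g_r : Pⁿ⁺ʳ → Pʳ` lift `β` and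
commute with the differentials of `P`; see `extProd_extMk`. The composition `Ext.comp` is computed by lifts to the
shifted complex instead, whose differential carries the sign `(-1)ⁿ`; this accounts for the sign
`(-1)ᵐⁿ` here. -/
def extProd {m n : ℕ} (a : Abelian.Ext X X m) (b : Abelian.Ext X X n) :
    Abelian.Ext X X (n + m) :=
  (-1 : ℤ) ^ (m * n) • b.comp a rfl

section Lifting

open CochainComplex HomComplex Abelian

variable (R : ProjectiveResolution X) {m n : ℕ} (g : ∀ r, R.complex.X (n + r) ⟶ R.complex.X r)

/-- The cochain with components `(-1)ⁿʳ g_r`. -/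
def liftCochain : Cochain R.cochainComplex R.cochainComplex n :=
  Cochain.mk (fun p q hpq =>
    if h : q ≤ 0 then
      (R.cochainComplexXIso p (n + (-q).toNat) (by push_cast; omega)).hom ≫
        ((-1 : ℤ) ^ (n * (-q).toNat) • g (-q).toNat) ≫
        (R.cochainComplexXIso q (-q).toNat (by omega)).inv
    else 0)

theorem liftCochain_v (r : ℕ) (p q : ℤ) (hpq : p + n = q) (hq : -(r : ℤ) = q) :
    (liftCochain R g).v p q hpq = (R.cochainComplexXIso p (n + r) (by push_cast; omega)).hom ≫
      ((-1 : ℤ) ^ (n * r) • g r) ≫ (R.cochainComplexXIso q r hq).inv := by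
  obtain rfl : r = (-q).toNat := by omega
  simp only [liftCochain, Cochain.mk_v]
  rw [dif_pos (by omega)]

theorem delta_liftCochain (hg : ∀ r, R.complex.d (n + (r + 1)) (n + r) ≫ g r =
      g (r + 1) ≫ R.complex.d (r + 1) r) :
    δ (n : ℤ) (n + 1) (liftCochain R g) = 0 := by
  ext p q hpq
  rw [δ_v n (n + 1) rfl (liftCochain R g) p q hpq (q - 1) (p + 1) (by omega) rfl]
  by_cases hq : q ≤ 0
  · obtain ⟨r, hr⟩ : ∃ r : ℕ, -(r : ℤ) = q := ⟨(-q).toNat, by omega⟩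
    rw [liftCochain_v R g (r + 1) p (q - 1) (by omega) (by push_cast; omega),
      liftCochain_v R g r (p + 1) q (by omega) hr,
      R.cochainComplex_d (q - 1) q (r + 1) r (by push_cast; omega) hr,
      R.cochainComplex_d p (p + 1) (n + (r + 1)) (n + r) (by push_cast; omega)
        (by push_cast; omega)]
    have := hg r
    simp only [Preadditive.zsmul_comp, Preadditive.comp_zsmul, Category.assoc,
      Iso.inv_hom_id_assoc, Units.smul_def, Cochain.zero_v]
    rw [reassoc_of% this]
    rw [smul_smul, ← add_smul]
    convert zero_smul ℤ _
    rw [Int.negOnePow_succ]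
    simp [Int.negOnePow_def]
    ring
  · exact (CochainComplex.isZero_of_isStrictlyLE R.cochainComplex 0 q (by omega)).eq_of_tgt _ _

/-- The cocycle with components `(-1)ⁿʳ g_r`. -/
def liftCocycle (hg : ∀ r, R.complex.d (n + (r + 1)) (n + r) ≫ g r =
      g (r + 1) ≫ R.complex.d (r + 1) r) :
    Cocycle R.cochainComplex R.cochainComplex n :=
  Cocycle.mk (liftCochain R g) (n + 1) rfl (delta_liftCochain R g hg)

/-- A cocycle `Pⁿ → X`, as a cocycle with values in the complex `X`. -/
def singleCocycle (φ : R.complex.X n ⟶ X) (hφ : R.complex.d (n + 1) n ≫ φ = 0) :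
    Cocycle R.cochainComplex ((singleFunctor C 0).obj X) n :=
  Cocycle.toSingleMk ((R.cochainComplexXIso (-n) n rfl).hom ≫ φ) (by simp)
    (-(n + 1 : ℕ)) (by lia) (by rw [R.cochainComplex_d _ _ (n + 1) n rfl rfl]; simp [hφ])

theorem liftCocycle_postcomp (φ : R.complex.X n ⟶ X) (hφ : R.complex.d (n + 1) n ≫ φ = 0)
    (hg0 : g 0 ≫ R.π.f 0 = φ)
    (hg : ∀ r, R.complex.d (n + (r + 1)) (n + r) ≫ g r = g (r + 1) ≫ R.complex.d (r + 1) r) :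
    (liftCocycle R g hg).postcomp R.π' = singleCocycle R φ hφ := by
  ext : 1
  apply (Cochain.toSingleEquiv (p := -(n : ℤ)) (q := 0) (by simp)).injective
  simp [Cochain.toSingleEquiv, singleCocycle]
  have := liftCochain_v R g 0 (-(n:ℤ)) 0 (by simp) (by simp)
  simp [liftCocycle, R.π'_f_zero]
  simp [this]
  rw [← hg0]
  have aux : ∀ {A B D E F G : C} (a : A ⟶ B) (b : B ⟶ D) (i : E ≅ D) (p : D ⟶ F) (s : F ⟶ G)
      {H : C} (t : G ⟶ H),
      ((a ≫ b ≫ i.inv) ≫ i.hom ≫ p ≫ s) ≫ t = (a ≫ (b ≫ p) ≫ s) ≫ t := by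
    intros
    simp
  exact aux _ _ _ _ _ _

theorem liftCocycle_comp (ψ : R.complex.X m ⟶ X) (hψ : R.complex.d (m + 1) m ≫ ψ = 0)
    (hg : ∀ r, R.complex.d (n + (r + 1)) (n + r) ≫ g r = g (r + 1) ≫ R.complex.d (r + 1) r)
    (h' : R.complex.d (n + m + 1) (n + m) ≫ g m ≫ ψ = 0) :
    ShiftedHom.comp (Cocycle.equivHomShift.symm (liftCocycle R g hg))
      (Cocycle.equivHomShift.symm (singleCocycle R ψ hψ))
        (by push_cast; omega : (m : ℤ) + n = (n + m : ℕ)) =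
      (-1 : ℤ) ^ (n * m) • Cocycle.equivHomShift.symm (singleCocycle R (g m ≫ ψ) h') := by
  rw [← map_zsmul]
  apply Cocycle.equivHomShift.injective
  rw [AddEquiv.apply_symm_apply]
  ext : 1
  apply (Cochain.toSingleEquiv (p := -((n + m : ℕ) : ℤ)) (q := 0) (by simp)).injective
  have hz := liftCochain_v R g m (-((n : ℤ) + m)) (-((n : ℤ) + m) + n) rfl (by omega)
  have ht : ∀ (p : ℤ) (hp : p + m = 0),
      (Cochain.toSingleMk ((R.cochainComplexXIso (-m) m rfl).hom ≫ ψ)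
        (by simp : (-(m : ℤ)) + m = 0)).v p 0 hp =
      (R.cochainComplexXIso p m (by omega)).hom ≫ ψ ≫
        (HomologicalComplex.singleObjXSelf (.up ℤ) 0 X).inv := by
    intro p hp
    obtain rfl : p = -m := by omega
    simp
    rfl
  simp [Cochain.toSingleEquiv, singleCocycle, ShiftedHom.comp, Cocycle.equivHomShift_apply,
    Cocycle.equivHomShift_symm_apply, Cochain.rightUnshift_v _ _ _ _ _ _ _ (add_zero _)]
  rw [Cochain.rightShift_v _ _ _ _ _ _ _ (-((n : ℤ) + m) + n) rfl,
    Cochain.rightShift_v _ _ _ _ _ _ _ 0 (by omega), ht,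
    CochainComplex.shiftFunctorAdd'_inv_app_f']
  simp only [liftCocycle, Cocycle.mk_coe, hz]
  simp [HomologicalComplex.XIsoOfEq]
  have aux : ∀ {A B D E F G H I : C} (ε : ℤ) (a : A ⟶ B) (b : B ⟶ D) (i : E ≅ D) (p : D ⟶ F)
      (s : F ⟶ G) (e1 : G = H) (e2 : H = I) (e3 : I = G) (t : G ⟶ F),
      ((((ε • (a ≫ b ≫ i.inv)) ≫ 𝟙 _) ≫ ((i.hom ≫ p ≫ s) ≫ eqToHom e1) ≫ eqToHom e2) ≫
        eqToHom e3) ≫ t = (ε • (a ≫ b ≫ p ≫ s)) ≫ t := by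
    intros
    subst_vars
    simp
  exact aux _ _ _ _ _ _ _ _ _ _

/-- The product of the classes of two cocycles `ψ : Pᵐ → X` and `φ : Pⁿ → X` is the class of
`ψ g_m`, where the maps `g_r : Pⁿ⁺ʳ → Pʳ` lift `φ` and commute with the differentials. -/
theorem extProd_extMk (φ : R.complex.X n ⟶ X) (ψ : R.complex.X m ⟶ X)
    (hφ : R.complex.d (n + 1) n ≫ φ = 0) (hψ : R.complex.d (m + 1) m ≫ ψ = 0)
    (hg0 : g 0 ≫ R.π.f 0 = φ)
    (hg : ∀ r, R.complex.d (n + (r + 1)) (n + r) ≫ g r = g (r + 1) ≫ R.complex.d (r + 1) r)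
    (h' : R.complex.d (n + m + 1) (n + m) ≫ g m ≫ ψ = 0) :
    extProd (R.extMk ψ (m + 1) rfl hψ) (R.extMk φ (n + 1) rfl hφ) =
      R.extMk (g m ≫ ψ) (n + m + 1) rfl h' := by
  have := HasDerivedCategory.standard C
  unfold extProd
  have key : (R.extMk φ (n+1) rfl hφ).comp (R.extMk ψ (m+1) rfl hψ) rfl = 
     (-1 : ℤ) ^ (n * m) • R.extMk (g m ≫ ψ) (n+m+1) rfl h' := by
    ext
    rw [Ext.comp_hom]
    have e1 : ∀ {n : ℕ} (φ : R.complex.X n ⟶ X) (hφ), (R.extMk φ (n+1) rfl hφ).hom = 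
      (ShiftedHom.mk₀ _ rfl ((DerivedCategory.singleFunctorIsoCompQ C 0).hom.app X ≫
      inv (DerivedCategory.Q.map R.π'))).comp
        ((ShiftedHom.map (Cocycle.equivHomShift.symm (singleCocycle R φ hφ)) DerivedCategory.Q).comp
          (.mk₀ _ rfl ((DerivedCategory.singleFunctorIsoCompQ C 0).inv.app X))
            (zero_add _)) (add_zero _) := fun φ hφ => R.extMk_hom φ _ _ hφ
    rw [e1 φ hφ, e1 ψ hψ]
    rw [← liftCocycle_postcomp R g φ hφ hg0 hg, Cocycle.equivHomShift_symm_postcomp, ← ShiftedHom.comp_mk₀ _ 0 rfl,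
      ShiftedHom.map_comp, ShiftedHom.map_mk₀]
    have hN : (m : ℤ) + n = ((n + m : ℕ) : ℤ) := by push_cast; omega
    rw [ShiftedHom.comp_assoc _ _ _ (add_zero _) hN (by push_cast; omega),
       ShiftedHom.comp_assoc _ _ _ (zero_add _) (add_zero (m : ℤ)) (by push_cast; omega),
       ShiftedHom.mk₀_comp_mk₀_assoc]
    rw [ShiftedHom.comp_assoc _ _ _ (zero_add _) (add_zero (m : ℤ)) (by push_cast; omega),
       ShiftedHom.mk₀_comp_mk₀_assoc]
    simp only [Iso.inv_hom_id_app_assoc, IsIso.hom_inv_id, ShiftedHom.mk₀_id_comp]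
    have h2 := liftCocycle_comp R g ψ hψ hg h'
    have h3 := congrArg (fun z => ShiftedHom.map z DerivedCategory.Q) h2
    simp only [ShiftedHom.map_comp] at h3
    have h4 : ((-1 : ℤ) ^ (n * m) • R.extMk (g m ≫ ψ) (n+m+1) rfl h').hom = 
       (-1 : ℤ) ^ (n * m) • (R.extMk (g m ≫ ψ) (n+m+1) rfl h').hom :=
        map_zsmul (Ext.homAddEquiv (X := X) (Y := X) (n := n + m)) _ _
    rw [h4, e1 (g m ≫ ψ) h']
    rcases neg_one_pow_eq_or ℤ (n*m) with h5 | h5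
    · rw [h5, one_smul] at h3 ⊢
      rw [← h3]
      rw [ShiftedHom.comp_assoc _ _ _ hN (zero_add _) (by push_cast; omega)]
    · rw [h5, neg_one_smul] at h3 ⊢
      have h6 : ∀ a : ShiftedHom R.cochainComplex ((singleFunctor C 0).obj X) ((n+m : ℕ) : ℤ), (-a).map DerivedCategory.Q = - a.map DerivedCategory.Q := by
        intro a; simp [ShiftedHom.map]
      rw [h6] at h3
      rw [eq_comm, neg_eq_iff_eq_neg] at h3
      rw [h3]
      simp
      rw [ShiftedHom.comp_assoc _ _ _ hN (zero_add _) (by push_cast; omega)]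
  rw [key, smul_smul, mul_comm m n, ← pow_add, ← two_mul, pow_mul]
  simp

end Lifting

end YonedaProduct

/-! ### Right modules over a quotient ring -/

section RightModules

variable {A : Type u} [Ring A]

/-- A two-sided ideal, viewed as a right submodule of the ring. -/
def rightSubmodule (K : Ideal A) [K.IsTwoSided] : Submodule Aᵐᵒᵖ A where
  carrier := K
  add_mem' := K.add_mem
  zero_mem' := K.zero_mem
  smul_mem' a _ hx := K.mul_mem_right a.unop hx

variable (I : Ideal A) [I.IsTwoSided] {X : Type v} [AddCommGroup X] [Module Aᵐᵒᵖ X]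

/-- The action of `A / I` on a right `A`-module annihilated by `I`, as a ring homomorphism. -/
def quotientAction (hX : ∀ a ∈ I, ∀ x : X, op a • x = 0) :
    (A ⧸ I)ᵐᵒᵖ →+* AddMonoid.End X :=
  let φ : A →+* (AddMonoid.End X)ᵐᵒᵖ :=
    { toFun := fun a => op (Module.toAddMonoidEnd Aᵐᵒᵖ X (op a))
      map_one' := by simp
      map_mul' := fun a b => by simp
      map_zero' := by simp
      map_add' := fun a b => by simp }
  let ψ : A ⧸ I →+* (AddMonoid.End X)ᵐᵒᵖ :=
    Ideal.Quotient.lift I φ (fun a ha => unop_injective (AddMonoidHom.ext (fun x => hX a ha x)))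
  { toFun := fun a => (ψ a.unop).unop
    map_one' := by simp
    map_mul' := fun a b => by simp
    map_zero' := by simp
    map_add' := fun a b => by simp }

/-- A right `A`-module annihilated by `I` is a right `A / I`-module, with `x · (a + I) = x · a`. -/
abbrev quotientModule (hX : ∀ a ∈ I, ∀ x : X, op a • x = 0) : Module (A ⧸ I)ᵐᵒᵖ X :=
  Module.compHom X (quotientAction I hX)

end RightModules

/-! ### The algebra `kQ / I` -/

section Algebra

variable {k : Type u} [Field k] {V : Type v} [Quiver.{w} V] [Fintype V]
  (I : Ideal (PathAlgebra k V)) [I.IsTwoSided]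

/-- The algebra `kQ / I`. -/
abbrev Lam : Type (max u v w) := PathAlgebra k V ⧸ I

/-- The ideal `𝔯 = J / I` of `kQ / I`. -/
abbrev rad : Ideal (Lam I) := (arrowIdeal k V).map (Ideal.Quotient.mk I)

/-- The right module `Λ / 𝔯`. -/
abbrev ModRad : Type (max u v w) := Lam I ⧸ rightSubmodule (rad I)

/-- The object `Λ / 𝔯` in the category of right `Λ`-modules. -/
abbrev modRad : ModuleCat.{max u v w} (Lam I)ᵐᵒᵖ := ModuleCat.of (Lam I)ᵐᵒᵖ (ModRad I)

/-- The residue class in `Λ / 𝔯` of an element of the path algebra. -/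
def toModRad : PathAlgebra k V →+ ModRad I :=
  (rightSubmodule (rad I)).mkQ.toAddMonoidHom.comp (Ideal.Quotient.mk I).toAddMonoidHom

/-- A linear resolution of `Λ / 𝔯`: a resolution of the degree zero part `Λ / 𝔯` of `Λ` by graded
projective right `Λ`-modules, with differentials and augmentation of degree zero, in which the
`n`-th term is generated in degree `n`. Here `Λ` is graded by the length of paths. -/
structure LinearResolution where
  /-- The terms of the resolution. -/
  P : ℕ → Type (max u v w)
  /-- The additive structure. -/
  [addCommGroup : ∀ n, AddCommGroup (P n)]
  /-- The right action of `Λ`. -/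
  [module : ∀ n, Module (Lam I)ᵐᵒᵖ (P n)]
  /-- `gr n j` is the degree `j` part of the `n`-th term. -/
  gr : ∀ n, ℕ → AddSubgroup (P n)
  isInternal : ∀ n, DirectSum.IsInternal (gr n)
  smul_mem : ∀ n i j, ∀ x ∈ gr n i, ∀ a ∈ lengthPart k V j,
    op (Ideal.Quotient.mk I a) • x ∈ gr n (i + j)
  projective : ∀ n, Module.Projective (Lam I)ᵐᵒᵖ (P n)
  /-- The differential. -/
  d : ∀ n, P (n + 1) →ₗ[(Lam I)ᵐᵒᵖ] P n
  d_mem : ∀ n j, ∀ x ∈ gr (n + 1) j, d n x ∈ gr n j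
  /-- The augmentation. -/
  aug : P 0 →ₗ[(Lam I)ᵐᵒᵖ] ModRad I
  aug_eq_zero : ∀ j, j ≠ 0 → ∀ x ∈ gr 0 j, aug x = 0
  aug_surjective : Function.Surjective aug
  exact_zero : Function.Exact (d 0) aug
  exact_succ : ∀ n, Function.Exact (d (n + 1)) (d n)
  /-- The `n`-th term is generated in degree `n`. -/
  generated : ∀ n, Submodule.span (Lam I)ᵐᵒᵖ (gr n n : Set (P n)) = ⊤

/-- `kQ / I` is a Koszul algebra: `I` is homogeneous with respect to the length of paths (that is,
spanned by homogeneous elements), and the degree zero part of the graded algebra `kQ / I` has a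
linear resolution. -/
def IsKoszul : Prop :=
  (∀ x ∈ I, x ∈ Submodule.span k {y | y ∈ I ∧ IsLengthHomogeneous y}) ∧
    Nonempty (LinearResolution I)

end Algebra

/-! ### Resolutions defined by elements of the path algebra -/

section Resolution

variable {k : Type u} [Field k] {V : Type v} [Quiver.{w} V] [Fintype V]
  (I : Ideal (PathAlgebra k V)) [I.IsTwoSided] {s : ℕ → ℕ} (f : ∀ n, Fin (s n) → PathAlgebra k V)

/-- The right ideal `∑ᵢ fⁿᵢ R` of `R = kQ`. -/
def rightSpan (n : ℕ) : Submodule (PathAlgebra k V)ᵐᵒᵖ (PathAlgebra k V) :=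
  Submodule.span _ (Set.range (f n))

/-- The right ideal `∑ᵢ fⁿᵢ I` of `R = kQ`. -/
def rightSpanI (n : ℕ) : Submodule (PathAlgebra k V)ᵐᵒᵖ (PathAlgebra k V) :=
  Submodule.span _ {x | ∃ (i : Fin (s n)), ∃ a ∈ I, x = f n i * a}

theorem mul_mem_rightSpanI {n : ℕ} {x : PathAlgebra k V} (hx : x ∈ rightSpan f n)
    {a : PathAlgebra k V} (ha : a ∈ I) : x * a ∈ rightSpanI I f n := by
  induction hx using Submodule.span_induction generalizing a with
  | mem x h =>
    obtain ⟨i, rfl⟩ := h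
    exact Submodule.subset_span ⟨i, a, ha, rfl⟩
  | zero => simp
  | add x y _ _ hx hy => rw [add_mul]; exact add_mem (hx ha) (hy ha)
  | smul r x _ hx =>
    have h : r • x * a = x * (r.unop * a) := by
      rw [← mul_assoc]; rfl
    rw [h]
    exact hx (I.mul_mem_left _ ha)

/-- The `n`-th term `Fⁿ = ∐ᵢ fⁿᵢ R / ∐ᵢ fⁿᵢ I`. -/
def FTerm (n : ℕ) : Type (max u v w) :=
  rightSpan f n ⧸ (rightSpanI I f n).submoduleOf (rightSpan f n)

instance (n : ℕ) : AddCommGroup (FTerm I f n) :=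
  inferInstanceAs (AddCommGroup (rightSpan f n ⧸ (rightSpanI I f n).submoduleOf (rightSpan f n)))

instance (n : ℕ) : Module (PathAlgebra k V)ᵐᵒᵖ (FTerm I f n) :=
  inferInstanceAs (Module (PathAlgebra k V)ᵐᵒᵖ
    (rightSpan f n ⧸ (rightSpanI I f n).submoduleOf (rightSpan f n)))

/-- The residue class in `Fⁿ` of an element of `∐ᵢ fⁿᵢ R`. -/
def toF (n : ℕ) : rightSpan f n →ₗ[(PathAlgebra k V)ᵐᵒᵖ] FTerm I f n :=
  ((rightSpanI I f n).submoduleOf (rightSpan f n)).mkQ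

theorem toF_surjective (n : ℕ) : Function.Surjective (toF I f n) :=
  Submodule.mkQ_surjective _

theorem toF_eq_zero_iff {n : ℕ} (x : rightSpan f n) :
    toF I f n x = 0 ↔ (x : PathAlgebra k V) ∈ rightSpanI I f n :=
  Submodule.Quotient.mk_eq_zero _

theorem smul_FTerm_eq_zero (n : ℕ) (a : PathAlgebra k V) (ha : a ∈ I) (x : FTerm I f n) :
    op a • x = 0 := by
  obtain ⟨x, rfl⟩ := toF_surjective I f n x
  rw [← map_smul, toF_eq_zero_iff]
  exact mul_mem_rightSpanI I f x.2 ha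

/-- `Fⁿ` is a right module over `Λ = kQ / I`. -/
instance (n : ℕ) : Module (Lam I)ᵐᵒᵖ (FTerm I f n) :=
  quotientModule I (smul_FTerm_eq_zero I f n)

theorem mk_smul_FTerm {n : ℕ} (a : PathAlgebra k V) (x : FTerm I f n) :
    op (Ideal.Quotient.mk I a) • x = op a • x := rfl

/-- The residue class of `fⁿᵢ` in `Fⁿ`. -/
def fbar (n : ℕ) (i : Fin (s n)) : FTerm I f n :=
  toF I f n ⟨f n i, Submodule.subset_span ⟨i, rfl⟩⟩

variable {f} in
/-- The map `Fⁿ⁺¹ → Fⁿ` induced by the inclusion `∐ᵢ fⁿ⁺¹ᵢ R ⊆ ∐ᵢ fⁿᵢ R`. -/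
def diff {n : ℕ} (h : rightSpan f (n + 1) ≤ rightSpan f n) :
    FTerm I f (n + 1) →ₗ[(Lam I)ᵐᵒᵖ] FTerm I f n where
  toFun := Submodule.mapQ ((rightSpanI I f (n + 1)).submoduleOf (rightSpan f (n + 1)))
    ((rightSpanI I f n).submoduleOf (rightSpan f n)) (Submodule.inclusion h) (by
      rintro ⟨x, hx'⟩ hx
      have hx : x ∈ rightSpanI I f (n + 1) := hx
      change x ∈ rightSpanI I f n
      refine Submodule.span_le.2 ?_ hx
      rintro _ ⟨i, a, ha, rfl⟩
      exact mul_mem_rightSpanI I f (h (Submodule.subset_span ⟨i, rfl⟩)) ha)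
  map_add' := map_add _
  map_smul' := by
    rintro ⟨a⟩ x
    obtain ⟨a, rfl⟩ := Ideal.Quotient.mk_surjective a
    exact map_smul (Submodule.mapQ ((rightSpanI I f (n + 1)).submoduleOf (rightSpan f (n + 1)))
      ((rightSpanI I f n).submoduleOf (rightSpan f n)) (Submodule.inclusion h) _) (op a) x

theorem diff_toF {n : ℕ} (h : rightSpan f (n + 1) ≤ rightSpan f n) (x : rightSpan f (n + 1)) :
    diff I h (toF I f (n + 1) x) = toF I f n ⟨x, h x.2⟩ := rfl

theorem toModRad_smul (a x : PathAlgebra k V) :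
    toModRad I (x * a) = op (Ideal.Quotient.mk I a) • toModRad I x := rfl

/-- The augmentation `F⁰ → Λ / 𝔯`, which sends the class of `x` to the class of `x`. -/
def aug : FTerm I f 0 →ₗ[(Lam I)ᵐᵒᵖ] ModRad I where
  toFun := QuotientAddGroup.lift ((rightSpanI I f 0).submoduleOf (rightSpan f 0)).toAddSubgroup
    ((toModRad I).comp (rightSpan f 0).subtype.toAddMonoidHom) (by
      rintro ⟨x, hx'⟩ hx
      have hx : x ∈ rightSpanI I f 0 := hx
      change toModRad I x = 0
      have h : x ∈ rightSubmodule I := by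
        refine Submodule.span_le.2 ?_ hx
        rintro _ ⟨i, a, ha, rfl⟩
        exact I.mul_mem_left _ ha
      have h' : Ideal.Quotient.mk I x = 0 := Ideal.Quotient.eq_zero_iff_mem.2 h
      change (rightSubmodule (rad I)).mkQ (Ideal.Quotient.mk I x) = 0
      rw [h', map_zero])
  map_add' := map_add _
  map_smul' := by
    rintro ⟨a⟩ x
    obtain ⟨a, rfl⟩ := Ideal.Quotient.mk_surjective a
    obtain ⟨x, rfl⟩ := toF_surjective I f 0 x
    rfl

theorem aug_toF (x : rightSpan f 0) : aug I f (toF I f 0 x) = toModRad I x := rfl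

/-- The elements `fⁿᵢ` of `R = kQ` define a minimal projective resolution of the right
`Λ`-module `Λ / 𝔯`. -/
structure DefinesMinimalResolution : Prop where
  uniform : ∀ n i, IsUniform (f n i)
  homogeneous : ∀ n i, IsLengthHomogeneous (f n i)
  /-- The sum `∑ᵢ fⁿᵢ R` is direct. -/
  direct : ∀ n, iSupIndep fun i => Submodule.span (PathAlgebra k V)ᵐᵒᵖ {f n i}
  eq_top : rightSpan f 0 = ⊤
  le : ∀ n, rightSpan f (n + 1) ≤ rightSpan f n
  projective : ∀ n, Module.Projective (Lam I)ᵐᵒᵖ (FTerm I f n)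
  exact_zero : Function.Exact (diff I (le 0)) (aug I f)
  exact_succ : ∀ n, Function.Exact (diff I (le (n + 1))) (diff I (le n))
  /-- The image of `Fⁿ⁺¹` is contained in `Fⁿ 𝔯`. -/
  minimal : ∀ n x, diff I (le n) x ∈
    Submodule.span (Lam I)ᵐᵒᵖ {z : FTerm I f n | ∃ a ∈ rad I, ∃ y, z = op a • y}

/-- The scalars `c r s i p q` are comultiplicative constants of the family `f`:
`f^{r+s}_i = ∑_{p,q} c r s i p q f^r_p f^s_q`, where a coefficient of a vanishing product
`f^r_p f^s_q` is taken to be zero. -/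
structure IsComultiplicative
    (c : ∀ r t : ℕ, Fin (s (r + t)) → Fin (s r) → Fin (s t) → k) : Prop where
  expand : ∀ r t i, f (r + t) i = ∑ p, ∑ q, c r t i p q • (f r p * f t q)
  normalized : ∀ r t i p q, f r p * f t q = 0 → c r t i p q = 0

namespace DefinesMinimalResolution

variable {I f} (h : DefinesMinimalResolution I f)

/-- The complex `⋯ → F² → F¹ → F⁰`. -/
def complex : ChainComplex (ModuleCat.{max u v w} (Lam I)ᵐᵒᵖ) ℕ :=
  ChainComplex.of (fun n => ModuleCat.of (Lam I)ᵐᵒᵖ (FTerm I f n))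
    (fun n => ModuleCat.ofHom (diff I (h.le n))) (fun n => by
      ext x
      exact (h.exact_succ n).apply_apply_eq_zero x)

theorem complex_d (n : ℕ) : h.complex.d (n + 1) n = ModuleCat.ofHom (diff I (h.le n)) := by
  simp only [complex, ChainComplex.of_d]

theorem aug_surjective (h : DefinesMinimalResolution I f) : Function.Surjective (aug I f) := by
  intro y
  obtain ⟨y, rfl⟩ := Submodule.mkQ_surjective _ y
  obtain ⟨y, rfl⟩ := Ideal.Quotient.mk_surjective y
  exact ⟨toF I f 0 ⟨y, h.eq_top ▸ Submodule.mem_top⟩, rfl⟩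

/-- The projective resolution `⋯ → F² → F¹ → F⁰ → Λ / 𝔯`. -/
def resolution : ProjectiveResolution (modRad I) where
  complex := h.complex
  projective n := by
    have := h.projective n
    exact (IsProjective.iff_projective (R := (Lam I)ᵐᵒᵖ) (FTerm I f n)).1 this
  π := (ChainComplex.toSingle₀Equiv _ _).symm ⟨ModuleCat.ofHom (aug I f), by
    rw [complex_d]
    ext x
    exact h.exact_zero.apply_apply_eq_zero x⟩
  quasiIso := ⟨fun n => by
    cases n with
    | zero =>
      rw [ChainComplex.quasiIsoAt₀_iff, ShortComplex.quasiIso_iff_of_zeros']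
      · refine (ShortComplex.exact_and_epi_g_iff_of_iso
          (S₂ := ShortComplex.mk (ModuleCat.ofHom (diff I (h.le 0))) (ModuleCat.ofHom (aug I f))
            (by ext x; exact h.exact_zero.apply_apply_eq_zero x)) ?_).2 ⟨?_, ?_⟩
        · exact ShortComplex.isoMk (Iso.refl _) (Iso.refl _) (Iso.refl _)
            ((Category.id_comp _).trans ((h.complex_d _).symm.trans (Category.comp_id _).symm))
            ((Category.id_comp _).trans (Category.comp_id _).symm)
        · exact (ShortComplex.ShortExact.moduleCat_exact_iff_function_exact _).2 h.exact_zero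
        · exact (ModuleCat.epi_iff_surjective _).2 h.aug_surjective
      all_goals rfl
    | succ n =>
      rw [quasiIsoAt_iff_exactAt']
      · rw [HomologicalComplex.exactAt_iff' _ (n + 1 + 1) (n + 1) n (by simp) (by simp)]
        refine (ShortComplex.exact_iff_of_iso
          (S₂ := ShortComplex.mk (ModuleCat.ofHom (diff I (h.le (n + 1))))
            (ModuleCat.ofHom (diff I (h.le n)))
            (by ext x; exact (h.exact_succ n).apply_apply_eq_zero x)) ?_).2 ?_
        · exact ShortComplex.isoMk (Iso.refl _) (Iso.refl _) (Iso.refl _)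
            ((Category.id_comp _).trans ((h.complex_d _).symm.trans (Category.comp_id _).symm))
            ((Category.id_comp _).trans ((h.complex_d _).symm.trans (Category.comp_id _).symm))
        · exact (ShortComplex.ShortExact.moduleCat_exact_iff_function_exact _).2 (h.exact_succ n)
      · apply ChainComplex.exactAt_succ_single_obj⟩

theorem rad_smul_modRad (a : Lam I) (ha : a ∈ rad I) (y : ModRad I) : op a • y = 0 := by
  obtain ⟨y, rfl⟩ := Submodule.mkQ_surjective _ y
  rw [← map_smul]
  exact (Submodule.Quotient.mk_eq_zero _).2 ((rad I).mul_mem_left y ha)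

/-- By minimality, every homomorphism `Fⁿ → Λ / 𝔯` is a cocycle. -/
theorem map_diff {n : ℕ} (φ : FTerm I f n →ₗ[(Lam I)ᵐᵒᵖ] ModRad I) (x : FTerm I f (n + 1)) :
    φ (diff I (h.le n) x) = 0 := by
  have hx := h.minimal n x
  refine Submodule.span_induction (p := fun z _ => φ z = 0) ?_ (map_zero φ) ?_ ?_ hx
  · rintro _ ⟨a, ha, y, rfl⟩
    rw [map_smul, rad_smul_modRad a ha]
  · intro x y _ _ hx hy
    rw [map_add, hx, hy, add_zero]
  · intro r x _ hx
    rw [map_smul, hx, smul_zero]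

/-- The element of `Extⁿ(Λ / 𝔯, Λ / 𝔯)` represented by a homomorphism `Fⁿ → Λ / 𝔯`. -/
def extClass {n : ℕ} (φ : FTerm I f n →ₗ[(Lam I)ᵐᵒᵖ] ModRad I) :
    Abelian.Ext (modRad I) (modRad I) n :=
  h.resolution.extMk (n := n) (ModuleCat.ofHom φ) (n + 1) rfl (by
    refine (congrArg (· ≫ ModuleCat.ofHom φ) (h.complex_d n)).trans ?_
    ext x
    exact h.map_diff φ x)

end DefinesMinimalResolution

end Resolution

end KoszulStructure

end

/-! Every homomorphism `Fⁿ → Λ/𝔯` kills `Fⁿ𝔯`. By minimality it is therefore a cocycle, and every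
coboundary is zero. So `Extⁿ` is `Hom(Fⁿ, Λ/𝔯)`, and its basis is dual to the generators `fⁿᵢ`
(`extEquiv`, `extBasis`). The rest is division inside `R = kQ`.

A path factors in only one way at a prescribed length. Hence left multiplication by a homogeneous `x
= x v ≠ 0` is injective on `v R` (`vertex_mul_eq_zero`), and an element of the direct sum `∐ᵢ fⁿᵢ R`
has unique coefficients in `t(fⁿᵢ) R`, which depend right linearly on it (`coord`).

Koszulity forces `fⁿᵢ` to have length exactly `n` (`deg_eq_self`). A comparison map from `F` to a
linear resolution `P` can be chosen of degree zero. A generator of length other than `n` then lands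
in `Pⁿ𝔯`. Going back to `F` gives a map homotopic to the identity, and by minimality this would put
the generator into `Fⁿ𝔯`.

Since `∐ fʳ⁺ᵐ R ⊆ ∐ fʳ R`, each `fʳ⁺ᵐᵢ` has coefficients at the `fʳₚ`, of length `m`. Induction on
`m` shows that they lie in `∐ fᵐ R` (`coordAdd_mem_rightSpan`): exactness of `F` gives this up to an
error in `∐ fᵐ⁻¹ I`, and the error has no component of length `m` because `I ⊆ J²`. An element of
length `m` in `∐ fᵐ R` is a `k`-combination of the `fᵐ_q`, which is the expansion.

For the product, take the coefficient of `fⁿⱼ`. This is a right linear map `∐ fⁿ⁺ʳ R → ∐ fʳ R`. It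
commutes with the differentials because these are inclusions, and for `r = 0` it lifts the dual of
`fⁿⱼ` (`liftDual_diff`, `aug_liftDual`). Composing it for `r = m` with the dual of `fᵐᵢ` reads off
the structure constants (`extProd_dual`). -/

noncomputable section

namespace KoszulStructure

/-! ### Unique factorization of paths and left cancellation -/

section PathAlgebra

variable {k : Type u} [Field k] {V : Type v} [Quiver.{w} V]

/-- Last arrows are peeled off `q` and `q'` together; the equal lengths of `p` and `p'` prevent one
of them from running out first. The middle vertices `b` and `b'` are not known to agree in advance,
hence the sigma types. -/
theorem path_comp_inj {a b b' c : V} (p : Quiver.Path a b) (q : Quiver.Path b c)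
    (p' : Quiver.Path a b') (q' : Quiver.Path b' c) (hl : p.length = p'.length)
    (h : p.comp q = p'.comp q') : (⟨a, b, p⟩ : AnyPath V) = ⟨a, b', p'⟩ ∧
      (⟨b, c, q⟩ : AnyPath V) = ⟨b', c, q'⟩ := by
  induction q with
  | nil =>
    cases q' with
    | nil =>
      simp only [Quiver.Path.comp_nil] at h
      subst h
      exact ⟨rfl, rfl⟩
    | cons q' e =>
      have := congrArg Quiver.Path.length h
      simp at this
      omega
  | cons q e ih =>
    cases q' with
    | nil =>
      have := congrArg Quiver.Path.length h
      simp at this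
      omega
    | cons q' e' =>
      simp only [Quiver.Path.comp_cons] at h
      obtain rfl := Quiver.Path.obj_eq_of_cons_eq_cons h
      have h1 := eq_of_heq (Quiver.Path.heq_of_cons_eq_cons h)
      have h2 := eq_of_heq (Quiver.Path.hom_heq_of_cons_eq_cons h)
      obtain ⟨h3, h4⟩ := ih q' h1
      subst h2
      refine ⟨h3, ?_⟩
      simp only [Sigma.mk.injEq] at h4 ⊢
      obtain ⟨rfl, h4⟩ := h4
      simp at h4
      simp [h4]

theorem vertex_mul_vertex (v : V) : (vertex v * vertex v : PathAlgebra k V) = vertex v := by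
  simp [vertex, ofPath_mul_ofPath]

variable [Fintype V]

/-- The coefficient of a path. -/
def coeff (p : AnyPath V) : PathAlgebra k V →ₗ[k] k := Finsupp.lapply p

theorem coeff_ofPath_self {a b : V} (p : Quiver.Path a b) :
    coeff (k := k) ⟨a, b, p⟩ (ofPath p) = 1 := Finsupp.single_eq_same

theorem coeff_ofPath_of_ne (p q : AnyPath V) (h : q ≠ p) :
    coeff (k := k) p (ofPath q.2.2) = 0 := Finsupp.single_eq_of_ne h.symm

theorem ext_coeff {x y : PathAlgebra k V} (h : ∀ p, coeff p x = coeff p y) : x = y :=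
  Finsupp.ext h

/-- In general this coefficient is a sum over all ways to cut the path. Homogeneity of `x` leaves
only the cut at length `d`. -/
theorem coeff_comp_mul {d : ℕ} {x : PathAlgebra k V} (hx : x ∈ lengthPart k V d)
    (y : PathAlgebra k V) {a b c : V} (p : Quiver.Path a b) (q : Quiver.Path b c)
    (hp : p.length = d) :
    coeff ⟨a, c, p.comp q⟩ (x * y) = coeff ⟨a, b, p⟩ x * coeff ⟨b, c, q⟩ y := by
  induction hx using Submodule.span_induction with
  | zero => simp only [map_zero, zero_mul]
  | add x x' _ _ hx hx' => simp only [map_add, hx, hx', add_mul]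
  | smul r x _ hx => simp only [smul_mul_aux, map_smul, hx, smul_eq_mul, mul_assoc]
  | mem x hx =>
    obtain ⟨a', b', p', hp', rfl⟩ := hx
    induction y using path_induction with
    | zero => simp only [map_zero, mul_zero]
    | add y y' hy hy' => simp only [map_add, hy, hy', mul_add]
    | smul r b'' c' q' =>
      simp only [mul_smul_aux, map_smul, smul_eq_mul]
      rw [mul_left_comm]
      congr 1
      by_cases h : (⟨a', b', p'⟩ : AnyPath V) = ⟨a, b, p⟩ ∧ (⟨b'', c', q'⟩ : AnyPath V) = ⟨b, c, q⟩
      · obtain ⟨h1, h2⟩ := h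
        cases h1
        cases h2
        rw [ofPath_mul_ofPath, coeff_ofPath_self, coeff_ofPath_self, coeff_ofPath_self, one_mul]
      · have h0 : coeff (k := k) ⟨a, b, p⟩ (ofPath p') * coeff ⟨b, c, q⟩ (ofPath q') = 0 := by
          by_cases h1 : (⟨a', b', p'⟩ : AnyPath V) = ⟨a, b, p⟩
          · rw [coeff_ofPath_of_ne ⟨b, c, q⟩ ⟨b'', c', q'⟩ (fun h2 => h ⟨h1, h2⟩), mul_zero]
          · rw [coeff_ofPath_of_ne ⟨a, b, p⟩ ⟨a', b', p'⟩ h1, zero_mul]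
        rw [h0]
        by_cases hb : b' = b''
        · subst hb
          rw [ofPath_mul_ofPath]
          refine coeff_ofPath_of_ne ⟨a, c, p.comp q⟩ ⟨a', c', p'.comp q'⟩ (fun h1 => h ?_)
          simp only [Sigma.mk.injEq] at h1
          obtain ⟨rfl, h1⟩ := h1
          simp only [heq_eq_eq, Sigma.mk.injEq] at h1
          obtain ⟨rfl, h1⟩ := h1
          exact path_comp_inj _ _ _ _ (hp'.trans hp.symm) (eq_of_heq h1)
        · rw [ofPath_mul_ofPath_of_ne _ _ hb, map_zero]

theorem coeff_eq_zero_of_mem_lengthPart {d : ℕ} {x : PathAlgebra k V}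
    (hx : x ∈ lengthPart k V d) (p : AnyPath V) (hp : p.2.2.length ≠ d) : coeff p x = 0 := by
  induction hx using Submodule.span_induction with
  | zero => exact map_zero _
  | add x x' _ _ hx hx' => rw [map_add, hx, hx', add_zero]
  | smul r x _ hx => rw [map_smul, hx, smul_zero]
  | mem x hx =>
    obtain ⟨a', b', p', hp', rfl⟩ := hx
    exact coeff_ofPath_of_ne p ⟨a', b', p'⟩ (by rintro rfl; exact hp hp')

theorem vertex_mul_vertex_of_ne {u v : V} (h : u ≠ v) :
    (vertex u * vertex v : PathAlgebra k V) = 0 :=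
  ofPath_mul_ofPath_of_ne _ _ h

theorem vertex_mem_lengthPart (v : V) : (vertex v : PathAlgebra k V) ∈ lengthPart k V 0 :=
  Submodule.subset_span ⟨v, v, _, rfl, rfl⟩

theorem coeff_mul_vertex_of_ne (x : PathAlgebra k V) (v : V) (p : AnyPath V) (hp : p.2.1 ≠ v) :
    coeff p (x * vertex v) = 0 := by
  induction x using path_induction with
  | zero => simp only [zero_mul_aux, map_zero]
  | add x x' hx hx' => simp only [add_mul_aux, map_add, hx, hx', add_zero]
  | smul r a b q =>
    simp only [smul_mul_aux, map_smul]
    by_cases h : b = v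
    · subst h
      rw [vertex, ofPath_mul_ofPath, Quiver.Path.comp_nil,
        coeff_ofPath_of_ne p ⟨a, b, q⟩ (by rintro rfl; exact hp rfl), smul_zero]
    · rw [vertex, ofPath_mul_ofPath_of_ne _ _ h, map_zero, smul_zero]

theorem coeff_vertex_mul_of_ne (x : PathAlgebra k V) (v : V) (p : AnyPath V) (hp : p.1 ≠ v) :
    coeff p (vertex v * x) = 0 := by
  induction x using path_induction with
  | zero => simp only [mul_zero_aux, map_zero]
  | add x x' hx hx' => simp only [mul_add_aux, map_add, hx, hx', add_zero]
  | smul r a b q =>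
    simp only [mul_smul_aux, map_smul]
    by_cases h : v = a
    · subst h
      rw [vertex, ofPath_mul_ofPath, Quiver.Path.nil_comp,
        coeff_ofPath_of_ne p ⟨v, b, q⟩ (by rintro rfl; exact hp rfl), smul_zero]
    · rw [vertex, ofPath_mul_ofPath_of_ne _ _ h, map_zero, smul_zero]

theorem coeff_vertex_mul (x : PathAlgebra k V) {v c : V} (q : Quiver.Path v c) :
    coeff ⟨v, c, q⟩ (vertex v * x) = coeff ⟨v, c, q⟩ x := by
  have := coeff_comp_mul (vertex_mem_lengthPart (k := k) v) x Quiver.Path.nil q rfl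
  rw [Quiver.Path.nil_comp] at this
  rw [this, vertex, coeff_ofPath_self, one_mul]

/-- Left multiplication by a non-zero homogeneous element `x = x v` is injective on `v kQ`. -/
theorem vertex_mul_eq_zero {x a : PathAlgebra k V} (hx : IsLengthHomogeneous x) (hx0 : x ≠ 0)
    {v : V} (hv : x * vertex v = x) (h : x * a = 0) : vertex v * a = 0 := by
  obtain ⟨d, hx⟩ := hx
  -- A path `p` in the support of `x` ends at `v`. For every `q` starting at `v`, the coefficient of
  -- `a` at `q` is then the coefficient of `x a` at `p q` divided by that of `x` at `p`.
  obtain ⟨⟨b, c, p⟩, hp⟩ : ∃ p, coeff p x ≠ 0 := by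
    by_contra! hc
    exact hx0 (ext_coeff fun p => by rw [hc, map_zero])
  have hpd : p.length = d := by
    by_contra hc
    exact hp (coeff_eq_zero_of_mem_lengthPart hx _ hc)
  obtain rfl : c = v := by
    by_contra hc
    rw [← hv] at hp
    exact hp (coeff_mul_vertex_of_ne x v _ hc)
  refine ext_coeff fun q => ?_
  rw [map_zero]
  by_cases hq : q.1 = c
  · obtain ⟨q1, q2, q⟩ := q
    obtain rfl : q1 = c := hq
    rw [coeff_vertex_mul]
    have := coeff_comp_mul hx a p q hpd
    rw [h, map_zero] at this
    exact (mul_eq_zero.1 this.symm).resolve_left hp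
  · exact coeff_vertex_mul_of_ne a c q hq

/-! ### The grading by length -/

variable (k V) in
/-- The component of length `d`. -/
def lengthComponent (d : ℕ) : PathAlgebra k V →ₗ[k] PathAlgebra k V :=
  Finsupp.linearCombination k
    (fun p : AnyPath V => if p.2.2.length = d then (ofPath p.2.2 : PathAlgebra k V) else 0)

theorem lengthComponent_ofPath (d : ℕ) {a b : V} (p : Quiver.Path a b) :
    lengthComponent k V d (ofPath p) = if p.length = d then ofPath p else 0 := by
  refine (Finsupp.linearCombination_single k (1 : k) (⟨a, b, p⟩ : AnyPath V)).trans ?_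
  exact one_smul k _

theorem ofPath_mem_lengthPart {a b : V} (p : Quiver.Path a b) :
    (ofPath p : PathAlgebra k V) ∈ lengthPart k V p.length :=
  Submodule.subset_span ⟨a, b, p, rfl, rfl⟩

theorem lengthComponent_mem (d : ℕ) (x : PathAlgebra k V) :
    lengthComponent k V d x ∈ lengthPart k V d := by
  induction x using path_induction with
  | zero => simp
  | add x x' hx hx' => rw [map_add]; exact add_mem hx hx'
  | smul r a b p =>
    rw [map_smul, lengthComponent_ofPath]
    split_ifs with h
    · subst h
      exact Submodule.smul_mem _ _ (ofPath_mem_lengthPart p)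
    · simp

theorem lengthComponent_of_mem {d : ℕ} {x : PathAlgebra k V} (hx : x ∈ lengthPart k V d) :
    lengthComponent k V d x = x := by
  induction hx using Submodule.span_induction with
  | zero => simp
  | add x x' _ _ hx hx' => rw [map_add, hx, hx']
  | smul r x _ hx => rw [map_smul, hx]
  | mem x hx =>
    obtain ⟨a, b, p, rfl, rfl⟩ := hx
    rw [lengthComponent_ofPath, if_pos rfl]

theorem lengthComponent_of_mem_ne {d e : ℕ} {x : PathAlgebra k V} (hx : x ∈ lengthPart k V e)
    (hde : e ≠ d) : lengthComponent k V d x = 0 := by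
  induction hx using Submodule.span_induction with
  | zero => simp
  | add x x' _ _ hx hx' => rw [map_add, hx, hx', add_zero]
  | smul r x _ hx => rw [map_smul, hx, smul_zero]
  | mem x hx =>
    obtain ⟨a, b, p, rfl, rfl⟩ := hx
    rw [lengthComponent_ofPath, if_neg hde]

/-- Allowing every `M` beyond the bound lets the bounds of two summands be replaced by their
maximum. -/
theorem exists_sum_lengthComponent (x : PathAlgebra k V) :
    ∃ N, ∀ M, N ≤ M → ∑ d ∈ Finset.range M, lengthComponent k V d x = x := by
  induction x using path_induction with
  | zero => exact ⟨0, by simp⟩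
  | add x x' hx hx' =>
    obtain ⟨N, hN⟩ := hx
    obtain ⟨N', hN'⟩ := hx'
    refine ⟨max N N', fun M hM => ?_⟩
    simp only [map_add, Finset.sum_add_distrib]
    rw [hN M (le_trans (le_max_left _ _) hM), hN' M (le_trans (le_max_right _ _) hM)]
  | smul r a b p =>
    refine ⟨p.length + 1, fun M hM => ?_⟩
    simp only [map_smul, lengthComponent_ofPath, ← Finset.smul_sum]
    rw [Finset.sum_ite_eq, if_pos (Finset.mem_range.2 (by omega))]

theorem mul_mem_lengthPart {d e : ℕ} {x y : PathAlgebra k V} (hx : x ∈ lengthPart k V d)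
    (hy : y ∈ lengthPart k V e) : x * y ∈ lengthPart k V (d + e) := by
  induction hx using Submodule.span_induction with
  | zero => rw [zero_mul_aux]; exact zero_mem _
  | add x x' _ _ hx hx' => rw [add_mul_aux]; exact add_mem hx hx'
  | smul r x _ hx => rw [smul_mul_aux]; exact Submodule.smul_mem _ _ hx
  | mem x hx =>
    obtain ⟨a, b, p, rfl, rfl⟩ := hx
    induction hy using Submodule.span_induction with
    | zero => rw [mul_zero_aux]; exact zero_mem _
    | add x x' _ _ hx hx' => rw [mul_add_aux]; exact add_mem hx hx'
    | smul r x _ hx => rw [mul_smul_aux]; exact Submodule.smul_mem _ _ hx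
    | mem y hy =>
      obtain ⟨b', c, q, rfl, rfl⟩ := hy
      by_cases h : b = b'
      · subst h
        rw [ofPath_mul_ofPath, ← Quiver.Path.length_comp]
        exact ofPath_mem_lengthPart _
      · rw [ofPath_mul_ofPath_of_ne _ _ h]
        exact zero_mem _

theorem lengthComponent_mul {d : ℕ} {x : PathAlgebra k V} (hx : x ∈ lengthPart k V d) (e : ℕ)
    (y : PathAlgebra k V) :
    lengthComponent k V (d + e) (x * y) = x * lengthComponent k V e y := by
  induction y using path_induction with
  | zero => simp only [mul_zero_aux, map_zero]
  | add y y' hy hy' => simp only [mul_add_aux, map_add, hy, hy']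
  | smul r a b q =>
    simp only [mul_smul_aux, map_smul]
    congr 1
    by_cases h : q.length = e
    · subst h
      rw [lengthComponent_of_mem (mul_mem_lengthPart hx (ofPath_mem_lengthPart q)),
        lengthComponent_of_mem (ofPath_mem_lengthPart q)]
    · rw [lengthComponent_of_mem_ne (mul_mem_lengthPart hx (ofPath_mem_lengthPart q)) (by omega),
        lengthComponent_of_mem_ne (ofPath_mem_lengthPart q) h, mul_zero_aux]

theorem lengthComponent_mul_of_lt {d e : ℕ} {x : PathAlgebra k V} (hx : x ∈ lengthPart k V d)
    (h : e < d) (y : PathAlgebra k V) : lengthComponent k V e (x * y) = 0 := by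
  induction y using path_induction with
  | zero => simp only [mul_zero_aux, map_zero]
  | add y y' hy hy' => simp only [mul_add_aux, map_add, hy, hy', add_zero]
  | smul r a b q =>
    simp only [mul_smul_aux, map_smul]
    rw [lengthComponent_of_mem_ne (mul_mem_lengthPart hx (ofPath_mem_lengthPart q)) (by omega),
      smul_zero]

theorem lengthComponent_zero_mul (x y : PathAlgebra k V) :
    lengthComponent k V 0 (x * y) = lengthComponent k V 0 x * lengthComponent k V 0 y := by
  induction x using path_induction with
  | zero => simp only [zero_mul_aux, map_zero]
  | add y y' hy hy' => simp only [add_mul_aux, map_add, hy, hy']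
  | smul r a b q =>
    simp only [smul_mul_aux, map_smul]
    congr 1
    by_cases h : q.length = 0
    · have hq := ofPath_mem_lengthPart (k := k) q
      rw [h] at hq
      rw [lengthComponent_of_mem hq]
      exact lengthComponent_mul hq 0 y
    · rw [lengthComponent_of_mem_ne (ofPath_mem_lengthPart q) h, zero_mul_aux,
        lengthComponent_mul_of_lt (ofPath_mem_lengthPart q) (by omega)]

theorem lengthComponent_one_mul (x y : PathAlgebra k V) (hx : lengthComponent k V 0 x = 0)
    (hy : lengthComponent k V 0 y = 0) : lengthComponent k V 1 (x * y) = 0 := by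
  have key : lengthComponent k V 1 (x * y) = lengthComponent k V 0 x * lengthComponent k V 1 y +
      lengthComponent k V 1 x * lengthComponent k V 0 y := by
    -- The product rule holds for all `x` and `y`, and the hypotheses would not pass to the summands
    -- of `x`.
    clear hx hy
    induction x using path_induction with
    | zero => simp only [zero_mul_aux, map_zero, add_zero]
    | add x x' hx hx' => simp only [add_mul_aux, map_add, hx, hx']; abel
    | smul r a b q =>
      simp only [smul_mul_aux, map_smul, ← smul_add]
      congr 1
      have hq := ofPath_mem_lengthPart (k := k) q
      obtain h | h | h : q.length = 0 ∨ q.length = 1 ∨ 1 < q.length := by omega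
      · rw [h] at hq
        rw [lengthComponent_of_mem hq, lengthComponent_of_mem_ne hq zero_ne_one, zero_mul_aux,
          add_zero]
        exact lengthComponent_mul hq 1 y
      · rw [h] at hq
        rw [lengthComponent_of_mem hq, lengthComponent_of_mem_ne hq one_ne_zero, zero_mul_aux,
          zero_add]
        exact lengthComponent_mul hq 0 y
      · rw [lengthComponent_mul_of_lt hq h, lengthComponent_of_mem_ne hq (by omega),
          lengthComponent_of_mem_ne hq (by omega), zero_mul_aux, zero_mul_aux, add_zero]
  rw [key, hx, hy, zero_mul_aux, mul_zero_aux, add_zero]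

/-- Paths of length zero are the vertices, which are orthogonal idempotents. -/
theorem lengthPart_zero_eq_smul_vertex {x : PathAlgebra k V} (hx : x ∈ lengthPart k V 0) (v : V) :
    ∃ c : k, vertex v * x = c • vertex v := by
  induction hx using Submodule.span_induction with
  | zero => exact ⟨0, by simp⟩
  | add x x' _ _ hx hx' =>
    obtain ⟨c, hc⟩ := hx
    obtain ⟨c', hc'⟩ := hx'
    exact ⟨c + c', by rw [mul_add_aux, hc, hc', add_smul]⟩
  | smul r x _ hx =>
    obtain ⟨c, hc⟩ := hx
    exact ⟨r * c, by rw [mul_smul_aux, hc, mul_smul]⟩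
  | mem x hx =>
    obtain ⟨a, b, p, hp, rfl⟩ := hx
    by_cases h : v = a
    · subst h
      obtain rfl := Quiver.Path.eq_of_length_zero p hp
      obtain rfl := Quiver.Path.eq_nil_of_length_zero p hp
      exact ⟨1, by rw [one_smul]; exact vertex_mul_vertex v⟩
    · exact ⟨0, by rw [zero_smul]; exact ofPath_mul_ofPath_of_ne _ _ h⟩

theorem mul_vertex_eq_smul_vertex {x : PathAlgebra k V} (hx : x ∈ lengthPart k V 0) (v : V) :
    ∃ c : k, x * vertex v = c • vertex v := by
  induction hx using Submodule.span_induction with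
  | zero => exact ⟨0, by simp⟩
  | add x x' _ _ hx hx' =>
    obtain ⟨c, hc⟩ := hx
    obtain ⟨c', hc'⟩ := hx'
    exact ⟨c + c', by rw [add_mul, hc, hc', add_smul]⟩
  | smul r x _ hx =>
    obtain ⟨c, hc⟩ := hx
    exact ⟨r * c, by rw [smul_mul_assoc, hc, mul_smul]⟩
  | mem x hx =>
    obtain ⟨a, b, p, hp, rfl⟩ := hx
    by_cases h : b = v
    · subst h
      obtain rfl := Quiver.Path.eq_of_length_zero p hp
      obtain rfl := Quiver.Path.eq_nil_of_length_zero p hp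
      exact ⟨1, by rw [one_smul]; exact vertex_mul_vertex _⟩
    · exact ⟨0, by rw [zero_smul]; exact ofPath_mul_ofPath_of_ne _ _ h⟩

/-! ### The arrow ideal in terms of lengths -/

theorem lengthComponent_zero_of_mem_arrowIdeal {x : PathAlgebra k V} (hx : x ∈ arrowIdeal k V) :
    lengthComponent k V 0 x = 0 := by
  -- Taking the component of length zero is multiplicative, so its kernel is a two-sided ideal, and
  -- it contains the arrows.
  let K : TwoSidedIdeal (PathAlgebra k V) := TwoSidedIdeal.mk' {x | lengthComponent k V 0 x = 0}
    (map_zero _) (fun {x y} hx hy => by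
      change lengthComponent k V 0 (x + y) = 0
      rw [map_add, show lengthComponent k V 0 x = 0 from hx,
        show lengthComponent k V 0 y = 0 from hy, add_zero])
    (fun {x} hx => by
      change lengthComponent k V 0 (-x) = 0
      rw [map_neg, show lengthComponent k V 0 x = 0 from hx, neg_zero])
    (fun {x y} hy => by
      change lengthComponent k V 0 (x * y) = 0
      rw [lengthComponent_zero_mul, show lengthComponent k V 0 y = 0 from hy, mul_zero])
    (fun {x y} hx => by
      change lengthComponent k V 0 (x * y) = 0
      rw [lengthComponent_zero_mul, show lengthComponent k V 0 x = 0 from hx, zero_mul])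
  have hK : ∀ x, x ∈ K ↔ lengthComponent k V 0 x = 0 := fun x =>
    TwoSidedIdeal.mem_mk' _ _ _ _ _ _ _
  rw [← hK]
  have h : TwoSidedIdeal.span {x : PathAlgebra k V | ∃ (a b : V) (e : a ⟶ b), x = ofPath e.toPath} ≤
      K := by
    rw [TwoSidedIdeal.span_le]
    rintro _ ⟨a, b, e, rfl⟩
    refine (hK _).2 ?_
    rw [lengthComponent_ofPath]
    simp
  exact h (TwoSidedIdeal.mem_asIdeal.1 hx)

theorem lengthPart_succ_le_arrowIdeal {d : ℕ} (hd : d ≠ 0) {x : PathAlgebra k V}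
    (hx : x ∈ lengthPart k V d) : x ∈ arrowIdeal k V := by
  induction hx using Submodule.span_induction with
  | zero => exact zero_mem _
  | add x x' _ _ hx hx' => exact add_mem hx hx'
  | smul r x _ hx => rw [Algebra.smul_def]; exact Ideal.mul_mem_left _ _ hx
  | mem x hx =>
    obtain ⟨a, b, p, hp, rfl⟩ := hx
    cases p with
    | nil => exact absurd hp.symm hd
    | cons p e =>
      rw [← Quiver.Path.comp_toPath_eq_cons, ← ofPath_mul_ofPath]
      refine Ideal.mul_mem_left _ _ ?_
      exact TwoSidedIdeal.mem_asIdeal.2 (TwoSidedIdeal.subset_span ⟨_, _, e, rfl⟩)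

theorem sub_lengthComponent_zero_mem_arrowIdeal (x : PathAlgebra k V) :
    x - lengthComponent k V 0 x ∈ arrowIdeal k V := by
  obtain ⟨N, hN⟩ := exists_sum_lengthComponent x
  have := hN (N + 1) (by omega)
  rw [Finset.sum_range_succ'] at this
  rw [sub_eq_of_eq_add this.symm]
  exact sum_mem fun d _ => lengthPart_succ_le_arrowIdeal (Nat.succ_ne_zero d)
    (lengthComponent_mem _ _)

theorem mem_arrowIdeal_iff {x : PathAlgebra k V} :
    x ∈ arrowIdeal k V ↔ lengthComponent k V 0 x = 0 :=
  ⟨lengthComponent_zero_of_mem_arrowIdeal, fun h => by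
    simpa [h] using sub_lengthComponent_zero_mem_arrowIdeal x⟩

theorem lengthComponent_one_of_mem_arrowIdeal_sq {x : PathAlgebra k V}
    (hx : x ∈ arrowIdeal k V ^ 2) : lengthComponent k V 1 x = 0 := by
  rw [Submodule.pow_succ (n := 1), Submodule.pow_one] at hx
  refine Submodule.mul_induction_on hx (fun a ha b hb => ?_) (fun a b ha hb => ?_)
  · exact lengthComponent_one_mul a b (mem_arrowIdeal_iff.1 ha) (mem_arrowIdeal_iff.1 hb)
  · rw [map_add, ha, hb, add_zero]

theorem arrowIdeal_sq_le : arrowIdeal k V ^ 2 ≤ arrowIdeal k V := by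
  intro x hx
  rw [Submodule.pow_succ (n := 1), Submodule.pow_one] at hx
  exact Submodule.mul_induction_on hx (fun a _ b hb => Ideal.mul_mem_left _ a hb)
    (fun a b ha hb => add_mem ha hb)

theorem vertex_ne_zero (v : V) : (vertex v : PathAlgebra k V) ≠ 0 := by
  intro h
  have := coeff_ofPath_self (k := k) (Quiver.Path.nil : Quiver.Path v v)
  rw [← vertex, h, map_zero] at this
  exact zero_ne_one this

theorem vertex_notMem_arrowIdeal (v : V) : (vertex v : PathAlgebra k V) ∉ arrowIdeal k V := by
  intro h
  rw [mem_arrowIdeal_iff, lengthComponent_of_mem (vertex_mem_lengthPart v)] at h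
  exact vertex_ne_zero v h

end PathAlgebra

/-! ### Coefficients in `∐ᵢ fⁿᵢ R` and homomorphisms out of `Fⁿ` -/

namespace DefinesMinimalResolution

variable {k : Type u} [Field k] {V : Type v} [Quiver.{w} V] [Fintype V]
  {I : Ideal (PathAlgebra k V)} [I.IsTwoSided] {s : ℕ → ℕ} {f : ∀ n, Fin (s n) → PathAlgebra k V}
  (h : DefinesMinimalResolution I f)

/-- The terminal vertex of `fⁿᵢ`, as an idempotent. -/
def term (n : ℕ) (i : Fin (s n)) : PathAlgebra k V := vertex (h.uniform n i).terminus

theorem mul_term (n : ℕ) (i : Fin (s n)) : f n i * h.term n i = f n i := by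
  have h1 := (h.uniform n i).2.choose_spec.choose_spec
  change f n i = _ * f n i * h.term n i at h1
  calc f n i * h.term n i = _ * f n i * h.term n i * h.term n i := by rw [← h1]
    _ = f n i := by rw [mul_assoc _ (h.term n i), term, vertex_mul_vertex]; exact h1.symm

theorem term_mul_term (n : ℕ) (i : Fin (s n)) : h.term n i * h.term n i = h.term n i :=
  vertex_mul_vertex _

theorem exists_coord {n : ℕ} (x : rightSpan f n) :
    ∃ a : Fin (s n) → PathAlgebra k V, ∑ i, f n i * a i = x := by
  obtain ⟨a, ha⟩ := (Submodule.mem_span_range_iff_exists_fun _).1 x.2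
  exact ⟨fun i => (a i).unop, ha⟩

/-- Directness makes each `fⁿᵢ aᵢ` vanish, and left cancellation applies. Only the part of `aᵢ` that
starts at the terminal vertex of `fⁿᵢ` is determined, since `fⁿᵢ` annihilates the rest. -/
theorem term_mul_eq_zero {n : ℕ} {a : Fin (s n) → PathAlgebra k V} (ha : ∑ i, f n i * a i = 0)
    (i : Fin (s n)) : h.term n i * a i = 0 := by
  have h1 := (iSupIndep_iff_finsetSum_eq_zero_imp_eq_zero _).1 (h.direct n) Finset.univ
    (fun i => f n i * a i)
    (fun i _ => Submodule.smul_mem _ (op (a i)) (Submodule.mem_span_singleton_self (f n i))) ha i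
    (Finset.mem_univ i)
  exact vertex_mul_eq_zero (h.homogeneous n i) (h.uniform n i).1 (h.mul_term n i) h1

theorem term_mul_eq {n : ℕ} {a b : Fin (s n) → PathAlgebra k V}
    (hab : ∑ i, f n i * a i = ∑ i, f n i * b i) (i : Fin (s n)) :
    h.term n i * a i = h.term n i * b i := by
  rw [← sub_eq_zero, ← mul_sub]
  refine h.term_mul_eq_zero (a := fun i => a i - b i) ?_ i
  simp only [mul_sub, Finset.sum_sub_distrib, hab, sub_self]

/-- The coefficients of an element of `∐ᵢ fⁿᵢ R`. -/
def coord (n : ℕ) (i : Fin (s n)) :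
    rightSpan f n →ₗ[(PathAlgebra k V)ᵐᵒᵖ] PathAlgebra k V where
  -- The factor `h.term n i` removes the dependence on the chosen coefficients.
  toFun x := h.term n i * (exists_coord x).choose i
  map_add' x y := by
    rw [← mul_add]
    refine h.term_mul_eq (b := fun i => (exists_coord x).choose i + (exists_coord y).choose i) ?_ i
    simp only [mul_add, Finset.sum_add_distrib, (exists_coord x).choose_spec,
      (exists_coord y).choose_spec, (exists_coord (x + y)).choose_spec, Submodule.coe_add]
  map_smul' r x := by
    change _ = h.term n i * _ * r.unop
    rw [mul_assoc]
    refine h.term_mul_eq (b := fun i => (exists_coord x).choose i * r.unop) ?_ i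
    simp only [← mul_assoc, ← Finset.sum_mul, (exists_coord x).choose_spec,
      (exists_coord (r • x)).choose_spec]
    rfl

theorem coord_eq {n : ℕ} {x : rightSpan f n} {a : Fin (s n) → PathAlgebra k V}
    (hx : (x : PathAlgebra k V) = ∑ i, f n i * a i) (i : Fin (s n)) :
    h.coord n i x = h.term n i * a i :=
  h.term_mul_eq ((exists_coord x).choose_spec.trans hx) i

theorem term_mul_coord {n : ℕ} (i : Fin (s n)) (x : rightSpan f n) :
    h.term n i * h.coord n i x = h.coord n i x := by
  change h.term n i * (h.term n i * _) = h.term n i * _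
  rw [← mul_assoc, term_mul_term]

theorem sum_coord {n : ℕ} (x : rightSpan f n) : ∑ i, f n i * h.coord n i x = x := by
  obtain ⟨a, ha⟩ := exists_coord x
  rw [← ha]
  refine Finset.sum_congr rfl fun i _ => ?_
  rw [h.coord_eq ha.symm, ← mul_assoc, mul_term]

variable (f) in
/-- `fⁿᵢ` as an element of `∐ᵢ fⁿᵢ R`. -/
def gen (n : ℕ) (i : Fin (s n)) : rightSpan f n := ⟨f n i, Submodule.subset_span ⟨i, rfl⟩⟩

theorem coord_gen (n : ℕ) (i j : Fin (s n)) :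
    h.coord n i (gen f n j) = if i = j then h.term n i else 0 := by
  rw [h.coord_eq (a := fun i => if i = j then 1 else 0) (by simp [gen])]
  split_ifs <;> simp

theorem sum_gen_smul {n : ℕ} (x : rightSpan f n) :
    ∑ i, op (h.coord n i x) • gen f n i = x := by
  refine Subtype.ext ?_
  rw [AddSubmonoidClass.coe_finsetSum]
  exact h.sum_coord x

theorem exists_mem_of_mem_rightSpanI {n : ℕ} {x : PathAlgebra k V} (hx : x ∈ rightSpanI I f n) :
    ∃ a : Fin (s n) → PathAlgebra k V, (∀ i, a i ∈ I) ∧ x = ∑ i, f n i * a i := by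
  induction hx using Submodule.span_induction with
  | mem x hx =>
    obtain ⟨j, a, ha, rfl⟩ := hx
    refine ⟨fun i => if i = j then a else 0, fun i => ?_, by simp⟩
    dsimp only
    split_ifs
    exacts [ha, zero_mem _]
  | zero => exact ⟨0, fun _ => zero_mem _, by simp⟩
  | add x y _ _ hx hy =>
    obtain ⟨a, ha, rfl⟩ := hx
    obtain ⟨b, hb, rfl⟩ := hy
    exact ⟨fun i => a i + b i, fun i => add_mem (ha i) (hb i), by
      simp [mul_add, Finset.sum_add_distrib]⟩
  | smul r x _ hx =>
    obtain ⟨a, ha, rfl⟩ := hx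
    refine ⟨fun i => a i * r.unop, fun i => I.mul_mem_right _ (ha i), ?_⟩
    simp only [← mul_assoc, ← Finset.sum_mul]
    rfl

theorem coord_mem {n : ℕ} {x : rightSpan f n} (hx : (x : PathAlgebra k V) ∈ rightSpanI I f n)
    (i : Fin (s n)) : h.coord n i x ∈ I := by
  obtain ⟨a, ha, hxa⟩ := exists_mem_of_mem_rightSpanI hx
  rw [h.coord_eq hxa]
  exact I.mul_mem_left _ (ha i)

theorem toF_gen (n : ℕ) (i : Fin (s n)) : toF I f n (gen f n i) = fbar I f n i := rfl

theorem toF_eq_sum {n : ℕ} (x : rightSpan f n) :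
    toF I f n x = ∑ i, op (Ideal.Quotient.mk I (h.coord n i x)) • fbar I f n i := by
  conv_lhs => rw [← h.sum_gen_smul x]
  rw [map_sum]
  simp only [map_smul]
  rfl

theorem fbar_smul_term (n : ℕ) (i : Fin (s n)) :
    op (Ideal.Quotient.mk I (h.term n i)) • fbar I f n i = fbar I f n i := by
  rw [mk_smul_FTerm]
  refine congrArg (toF I f n) (Subtype.ext ?_)
  exact h.mul_term n i

section Lift

variable {M : Type*} [AddCommGroup M] [Module (Lam I)ᵐᵒᵖ M]

/-- The additive map `∐ᵢ fⁿᵢ R → M` with prescribed values on the `fⁿᵢ`. -/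
def preLift {n : ℕ} (y : Fin (s n) → M) : rightSpan f n →+ M where
  toFun x := ∑ i, op (Ideal.Quotient.mk I (h.coord n i x)) • y i
  map_zero' := by simp
  map_add' a b := by simp [add_smul, Finset.sum_add_distrib]

/-- The homomorphism `Fⁿ → M` with prescribed values on the `fⁿᵢ`. -/
def lift {n : ℕ} (y : Fin (s n) → M) : FTerm I f n →ₗ[(Lam I)ᵐᵒᵖ] M where
  toFun := QuotientAddGroup.lift ((rightSpanI I f n).submoduleOf (rightSpan f n)).toAddSubgroup
    (h.preLift y) (by
      rintro ⟨x, hx'⟩ hx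
      have hx : x ∈ rightSpanI I f n := hx
      change ∑ i, op (Ideal.Quotient.mk I (h.coord n i ⟨x, hx'⟩)) • y i = 0
      refine Finset.sum_eq_zero fun i _ => ?_
      rw [Ideal.Quotient.eq_zero_iff_mem.2 (h.coord_mem (x := ⟨x, hx'⟩) hx i), op_zero, zero_smul])
  map_add' := map_add _
  map_smul' := by
    rintro ⟨a⟩ x
    obtain ⟨a, rfl⟩ := Ideal.Quotient.mk_surjective a
    obtain ⟨x, rfl⟩ := toF_surjective I f n x
    change ∑ i, op (Ideal.Quotient.mk I (h.coord n i (op a • x))) • y i =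
      op (Ideal.Quotient.mk I a) • ∑ i, op (Ideal.Quotient.mk I (h.coord n i x)) • y i
    rw [Finset.smul_sum]
    refine Finset.sum_congr rfl fun i _ => ?_
    rw [smul_smul, map_smul, ← op_mul, ← map_mul]
    rfl

theorem lift_toF {n : ℕ} (y : Fin (s n) → M) (x : rightSpan f n) :
    h.lift y (toF I f n x) = ∑ i, op (Ideal.Quotient.mk I (h.coord n i x)) • y i := rfl

/-- The value is `yᵢ t(fⁿᵢ)` and not `yᵢ`: the class of `fⁿᵢ` is fixed by its terminal vertex, so
its image must be as well. -/
theorem lift_fbar {n : ℕ} (y : Fin (s n) → M) (i : Fin (s n)) :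
    h.lift y (fbar I f n i) = op (Ideal.Quotient.mk I (h.term n i)) • y i := by
  rw [← toF_gen, lift_toF, Finset.sum_eq_single i]
  · rw [coord_gen, if_pos rfl]
  · intro j _ hj
    rw [coord_gen, if_neg hj, map_zero, op_zero, zero_smul]
  · simp

theorem hom_ext (h : DefinesMinimalResolution I f) {n : ℕ} {φ ψ : FTerm I f n →ₗ[(Lam I)ᵐᵒᵖ] M}
    (H : ∀ i, φ (fbar I f n i) = ψ (fbar I f n i)) : φ = ψ := by
  ext x
  obtain ⟨x, rfl⟩ := toF_surjective I f n x
  simp only [h.toF_eq_sum, map_sum, map_smul, H]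

end Lift

theorem toModRad_eq_zero_iff (hI : I ≤ arrowIdeal k V) (x : PathAlgebra k V) :
    toModRad I x = 0 ↔ x ∈ arrowIdeal k V := by
  change (rightSubmodule (rad I)).mkQ (Ideal.Quotient.mk I x) = 0 ↔ _
  rw [Submodule.mkQ_apply, Submodule.Quotient.mk_eq_zero]
  change Ideal.Quotient.mk I x ∈ rad I ↔ _
  rw [Ideal.mem_map_iff_of_surjective _ Ideal.Quotient.mk_surjective]
  constructor
  · rintro ⟨y, hy, hxy⟩
    have := hI (Ideal.Quotient.eq.1 hxy)
    rw [← sub_sub_cancel y x]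
    exact sub_mem hy this
  · exact fun hx => ⟨x, hx, rfl⟩

theorem toModRad_term_ne_zero (hI : I ≤ arrowIdeal k V) (n : ℕ) (i : Fin (s n)) :
    toModRad I (h.term n i) ≠ 0 := fun h1 =>
  vertex_notMem_arrowIdeal _ ((toModRad_eq_zero_iff hI _).1 h1)

/-- The homomorphism `Fⁿ → Λ / 𝔯` dual to `fⁿᵢ`. -/
def dual (n : ℕ) (i : Fin (s n)) : FTerm I f n →ₗ[(Lam I)ᵐᵒᵖ] ModRad I :=
  h.lift (fun j => if i = j then toModRad I (h.term n i) else 0)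

theorem dual_fbar (n : ℕ) (i j : Fin (s n)) :
    h.dual n i (fbar I f n j) = if i = j then toModRad I (h.term n i) else 0 := by
  rw [dual, lift_fbar]
  split_ifs with hij
  · subst hij
    rw [← toModRad_smul, term_mul_term]
  · rw [smul_zero]

theorem map_eq_zero_of_mem_rad {n : ℕ} (φ : FTerm I f n →ₗ[(Lam I)ᵐᵒᵖ] ModRad I) {x : FTerm I f n}
    (hx : x ∈ Submodule.span (Lam I)ᵐᵒᵖ {z : FTerm I f n | ∃ a ∈ rad I, ∃ y, z = op a • y}) :
    φ x = 0 := by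
  refine Submodule.span_induction (p := fun z _ => φ z = 0) ?_ (map_zero φ) ?_ ?_ hx
  · rintro _ ⟨a, ha, y, rfl⟩
    rw [map_smul, rad_smul_modRad a ha]
  · intro x y _ _ hx hy
    rw [map_add, hx, hy, add_zero]
  · intro r x _ hx
    rw [map_smul, hx, smul_zero]

/-- The dual homomorphism kills `Fⁿ𝔯` but sends this class to a vertex, which is non-zero modulo
`𝔯`. -/
theorem fbar_notMem_rad (h : DefinesMinimalResolution I f) (hI : I ≤ arrowIdeal k V) (n : ℕ) (i : Fin (s n)) :
    fbar I f n i ∉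
      Submodule.span (Lam I)ᵐᵒᵖ {z : FTerm I f n | ∃ a ∈ rad I, ∃ y, z = op a • y} := by
  intro hx
  have := map_eq_zero_of_mem_rad (h.dual n i) hx
  rw [dual_fbar, if_pos rfl] at this
  exact h.toModRad_term_ne_zero hI n i this

/-! ### Lengths -/

/-- The length of the paths in `fⁿᵢ`. -/
def deg (n : ℕ) (i : Fin (s n)) : ℕ := (h.homogeneous n i).choose

theorem mem_deg (n : ℕ) (i : Fin (s n)) : f n i ∈ lengthPart k V (h.deg n i) :=
  (h.homogeneous n i).choose_spec

theorem deg_eq {n d : ℕ} {i : Fin (s n)} (hd : f n i ∈ lengthPart k V d) : h.deg n i = d := by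
  by_contra hne
  have h1 := lengthComponent_of_mem_ne hd (Ne.symm hne)
  rw [lengthComponent_of_mem (h.mem_deg n i)] at h1
  exact (h.uniform n i).1 h1

theorem term_mem (n : ℕ) (i : Fin (s n)) : h.term n i ∈ lengthPart k V 0 :=
  vertex_mem_lengthPart _

/-- Discarding the parts of the wrong length from the expansion of `x` leaves an expansion of `x`,
so by uniqueness nothing was discarded. The case distinction is needed because `d - h.deg n i` is
truncated. -/
theorem coord_of_mem_lengthPart {n d : ℕ} {x : rightSpan f n}
    (hx : (x : PathAlgebra k V) ∈ lengthPart k V d) (i : Fin (s n)) :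
    h.coord n i x =
      if h.deg n i ≤ d then lengthComponent k V (d - h.deg n i) (h.coord n i x) else 0 := by
  have hx' : (x : PathAlgebra k V) = ∑ i, f n i *
      if h.deg n i ≤ d then lengthComponent k V (d - h.deg n i) (h.coord n i x) else 0 := by
    conv_lhs => rw [← lengthComponent_of_mem hx, ← h.sum_coord x, map_sum]
    refine Finset.sum_congr rfl fun i _ => ?_
    split_ifs with hi
    · conv_lhs => rw [← Nat.add_sub_cancel' hi]
      exact lengthComponent_mul (h.mem_deg n i) _ _
    · rw [mul_zero]
      exact lengthComponent_mul_of_lt (h.mem_deg n i) (not_le.1 hi) _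
  rw [h.coord_eq hx']
  split_ifs with hi
  · have := lengthComponent_mul (h.term_mem n i) (d - h.deg n i) (h.coord n i x)
    rw [zero_add, term_mul_coord] at this
    rw [← this, lengthComponent_of_mem (lengthComponent_mem _ _)]
  · rw [mul_zero]

theorem coord_mem_lengthPart {n d : ℕ} {x : rightSpan f n}
    (hx : (x : PathAlgebra k V) ∈ lengthPart k V d) (i : Fin (s n)) :
    h.coord n i x ∈ lengthPart k V (d - h.deg n i) := by
  rw [h.coord_of_mem_lengthPart hx]
  split_ifs
  exacts [lengthComponent_mem _ _, zero_mem _]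

theorem coord_eq_zero_of_lt {n d : ℕ} {x : rightSpan f n}
    (hx : (x : PathAlgebra k V) ∈ lengthPart k V d) (i : Fin (s n)) (hi : d < h.deg n i) :
    h.coord n i x = 0 := by
  rw [h.coord_of_mem_lengthPart hx, if_neg (not_le.2 hi)]

/-- Write `f⁰ᵢ = 1 · f⁰ᵢ` and take its own coefficient: right linearity exhibits the terminal vertex
as a left multiple of `f⁰ᵢ`. If `f⁰ᵢ` had positive length, that vertex would lie in `J`. -/
theorem deg_zero (i : Fin (s 0)) : h.deg 0 i = 0 := by
  by_contra hd
  have hJ : f 0 i ∈ arrowIdeal k V := lengthPart_succ_le_arrowIdeal hd (h.mem_deg 0 i)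
  have h1 : gen f 0 i = op (f 0 i) • (⟨1, h.eq_top ▸ Submodule.mem_top⟩ : rightSpan f 0) :=
    Subtype.ext (one_mul (f 0 i)).symm
  have h2 := h.coord_gen 0 i i
  rw [if_pos rfl, h1, map_smul] at h2
  refine vertex_notMem_arrowIdeal (k := k) (h.uniform 0 i).terminus ?_
  change h.term 0 i ∈ _
  rw [← h2]
  exact Ideal.mul_mem_left _ _ hJ

/-- The components of an element of `∐ᵢ fⁿᵢ R` lie in `∐ᵢ fⁿᵢ R`. -/
theorem lengthComponent_mem_rightSpan (h : DefinesMinimalResolution I f) {n : ℕ}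
    (x : rightSpan f n) (d : ℕ) : lengthComponent k V d (x : PathAlgebra k V) ∈ rightSpan f n := by
  rw [← h.sum_coord x, map_sum]
  refine sum_mem fun i _ => ?_
  by_cases hi : h.deg n i ≤ d
  · rw [← Nat.add_sub_cancel' hi, lengthComponent_mul (h.mem_deg n i)]
    exact Submodule.smul_mem _ (op _) (Submodule.subset_span ⟨i, rfl⟩)
  · rw [lengthComponent_mul_of_lt (h.mem_deg n i) (not_le.1 hi)]
    exact zero_mem _

end DefinesMinimalResolution

/-! ### Homogeneous components -/

section GradedProj

variable {M N : Type*} [AddCommGroup M] [AddCommGroup N] {ℳ : ℕ → AddSubgroup M}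
  {𝒩 : ℕ → AddSubgroup N} (hM : DirectSum.IsInternal ℳ) (hN : DirectSum.IsInternal 𝒩)

/-- The projection to the degree `j` part of a graded group. -/
def gradedProj (j : ℕ) : M →+ M :=
  letI := hM.chooseDecomposition
  (ℳ j).subtype.comp
    ((DFinsupp.evalAddMonoidHom j).comp (DirectSum.decomposeAddEquiv ℳ).toAddMonoidHom)

theorem gradedProj_mem (j : ℕ) (x : M) : gradedProj hM j x ∈ ℳ j :=
  SetLike.coe_mem _

theorem gradedProj_of_mem {j : ℕ} {x : M} (hx : x ∈ ℳ j) : gradedProj hM j x = x :=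
  letI := hM.chooseDecomposition
  DirectSum.decompose_of_mem_same ℳ hx

theorem gradedProj_of_mem_ne {i j : ℕ} {x : M} (hx : x ∈ ℳ i) (hij : i ≠ j) :
    gradedProj hM j x = 0 :=
  letI := hM.chooseDecomposition
  DirectSum.decompose_of_mem_ne ℳ hx hij

theorem graded_induction (hM : DirectSum.IsInternal ℳ) {p : M → Prop} (zero : p 0) (mem : ∀ i, ∀ x ∈ ℳ i, p x)
    (add : ∀ x y, p x → p y → p (x + y)) (x : M) : p x :=
  letI := hM.chooseDecomposition
  DirectSum.Decomposition.inductionOn ℳ zero (fun {i} x => mem i x x.2) add x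

/-- The shift `e` covers both the differential (`e = 0`) and the action of an element of length `e`.
-/
theorem gradedProj_map (g : M →+ N) (e : ℕ) (hg : ∀ i, ∀ x ∈ ℳ i, g x ∈ 𝒩 (i + e)) (j : ℕ)
    (x : M) : gradedProj hN (j + e) (g x) = g (gradedProj hM j x) := by
  induction x using graded_induction hM with
  | zero => simp
  | add x y hx hy => simp [hx, hy]
  | mem i x hx =>
    by_cases hij : i = j
    · subst hij
      rw [gradedProj_of_mem hM hx, gradedProj_of_mem hN (hg _ _ hx)]
    · rw [gradedProj_of_mem_ne hM hx hij, gradedProj_of_mem_ne hN (hg _ _ hx) (by omega), map_zero]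

end GradedProj

/-! ### Linear resolutions -/

namespace LinearResolution

variable {k : Type u} [Field k] {V : Type v} [Quiver.{w} V] [Fintype V]
  {I : Ideal (PathAlgebra k V)} [I.IsTwoSided] (L : LinearResolution I)

instance (n : ℕ) : AddCommGroup (L.P n) := L.addCommGroup n

instance (n : ℕ) : Module (Lam I)ᵐᵒᵖ (L.P n) := L.module n

/-- The complex `⋯ → P² → P¹ → P⁰`. -/
def complex : ChainComplex (ModuleCat.{max u v w} (Lam I)ᵐᵒᵖ) ℕ :=
  ChainComplex.of (fun n => ModuleCat.of (Lam I)ᵐᵒᵖ (L.P n))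
    (fun n => ModuleCat.ofHom (L.d n)) (fun n => by
      ext x
      exact (L.exact_succ n).apply_apply_eq_zero x)

theorem complex_d (n : ℕ) : L.complex.d (n + 1) n = ModuleCat.ofHom (L.d n) := by
  simp only [complex, ChainComplex.of_d]

/-- A linear resolution, as a projective resolution. -/
def resolution : ProjectiveResolution (modRad I) where
  complex := L.complex
  projective n := by
    have := L.projective n
    exact (IsProjective.iff_projective (R := (Lam I)ᵐᵒᵖ) (L.P n)).1 this
  π := (ChainComplex.toSingle₀Equiv _ _).symm ⟨ModuleCat.ofHom L.aug, by
    rw [complex_d]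
    ext x
    exact L.exact_zero.apply_apply_eq_zero x⟩
  quasiIso := ⟨fun n => by
    cases n with
    | zero =>
      rw [ChainComplex.quasiIsoAt₀_iff, ShortComplex.quasiIso_iff_of_zeros']
      · refine (ShortComplex.exact_and_epi_g_iff_of_iso
          (S₂ := ShortComplex.mk (ModuleCat.ofHom (L.d 0)) (ModuleCat.ofHom L.aug)
            (by ext x; exact L.exact_zero.apply_apply_eq_zero x)) ?_).2 ⟨?_, ?_⟩
        · exact ShortComplex.isoMk (Iso.refl _) (Iso.refl _) (Iso.refl _)
            ((Category.id_comp _).trans ((L.complex_d _).symm.trans (Category.comp_id _).symm))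
            ((Category.id_comp _).trans (Category.comp_id _).symm)
        · exact (ShortComplex.ShortExact.moduleCat_exact_iff_function_exact _).2 L.exact_zero
        · exact (ModuleCat.epi_iff_surjective _).2 L.aug_surjective
      all_goals rfl
    | succ n =>
      rw [quasiIsoAt_iff_exactAt']
      · rw [HomologicalComplex.exactAt_iff' _ (n + 1 + 1) (n + 1) n (by simp) (by simp)]
        refine (ShortComplex.exact_iff_of_iso
          (S₂ := ShortComplex.mk (ModuleCat.ofHom (L.d (n + 1))) (ModuleCat.ofHom (L.d n))
            (by ext x; exact (L.exact_succ n).apply_apply_eq_zero x)) ?_).2 ?_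
        · exact ShortComplex.isoMk (Iso.refl _) (Iso.refl _) (Iso.refl _)
            ((Category.id_comp _).trans ((L.complex_d _).symm.trans (Category.comp_id _).symm))
            ((Category.id_comp _).trans ((L.complex_d _).symm.trans (Category.comp_id _).symm))
        · exact (ShortComplex.ShortExact.moduleCat_exact_iff_function_exact _).2 (L.exact_succ n)
      · apply ChainComplex.exactAt_succ_single_obj⟩

/-- The projection of `Pⁿ` to its degree `j` part. -/
def proj (n j : ℕ) : L.P n →+ L.P n := gradedProj (L.isInternal n) j

theorem proj_d (n j : ℕ) (x : L.P (n + 1)) : L.proj n j (L.d n x) = L.d n (L.proj (n + 1) j x) :=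
  gradedProj_map (L.isInternal (n + 1)) (L.isInternal n) (L.d n).toAddMonoidHom 0
    (fun i x hx => L.d_mem n i x hx) j x

theorem proj_smul {n e : ℕ} (j : ℕ) (x : L.P n) {a : PathAlgebra k V} (ha : a ∈ lengthPart k V e) :
    L.proj n (j + e) (op (Ideal.Quotient.mk I a) • x) =
      op (Ideal.Quotient.mk I a) • L.proj n j x :=
  gradedProj_map (L.isInternal n) (L.isInternal n)
    (DistribSMul.toAddMonoidHom (L.P n) (op (Ideal.Quotient.mk I a))) e
    (fun i x hx => L.smul_mem n i e x hx a ha) j x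

theorem aug_proj_zero (x : L.P 0) : L.aug (L.proj 0 0 x) = L.aug x := by
  induction x using graded_induction (L.isInternal 0) with
  | zero => simp
  | add x y hx hy => simp [hx, hy]
  | mem i x hx =>
    by_cases hi : i = 0
    · subst hi
      rw [proj, gradedProj_of_mem _ hx]
    · rw [proj, gradedProj_of_mem_ne _ hx hi, map_zero, L.aug_eq_zero i hi x hx]

/-- The components of `Pⁿ` in degrees other than `n` lie in `Pⁿ 𝔯`. -/
theorem mem_rad_of_mem_gr {n j : ℕ} (hj : j ≠ n) {y : L.P n} (hy : y ∈ L.gr n j) :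
    y ∈ Submodule.span (Lam I)ᵐᵒᵖ {z : L.P n | ∃ a ∈ rad I, ∃ y, z = op a • y} := by
  -- Elements of `Pⁿ` are sums of `x a` with `x` of degree `n`. The degree `j` part of `x a` comes
  -- from the component of `a` of length `e` with `n + e = j`; here `e ≠ 0`, so that component lies
  -- in `J`. The claim is about projections because the summands themselves need not have degree
  -- `j`.
  have key : ∀ y : L.P n, L.proj n j y ∈
      Submodule.span (Lam I)ᵐᵒᵖ {z : L.P n | ∃ a ∈ rad I, ∃ y, z = op a • y} := by
    intro y
    have hy : y ∈ Submodule.span (Lam I)ᵐᵒᵖ (L.gr n n : Set (L.P n)) := by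
      rw [L.generated]
      trivial
    induction hy using Submodule.closure_induction with
    | zero => simp
    | add x y _ _ hx hy => rw [map_add]; exact add_mem hx hy
    | smul_mem r x hx =>
      obtain ⟨a⟩ := r
      obtain ⟨a, rfl⟩ := Ideal.Quotient.mk_surjective a
      change L.proj n j (op (Ideal.Quotient.mk I a) • x) ∈ _
      obtain ⟨N, hN⟩ := exists_sum_lengthComponent a
      rw [← hN N le_rfl, map_sum, Finset.op_sum, Finset.sum_smul, map_sum]
      refine sum_mem fun e _ => ?_
      have hmem := L.smul_mem n n e x hx _ (lengthComponent_mem e a)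
      by_cases he : n + e = j
      · subst he
        rw [proj, gradedProj_of_mem _ hmem]
        exact Submodule.subset_span ⟨_, Ideal.mem_map_of_mem _ (lengthPart_succ_le_arrowIdeal
          (by rintro rfl; exact hj rfl) (lengthComponent_mem e a)), x, rfl⟩
      · rw [proj, gradedProj_of_mem_ne _ hmem he]
        exact zero_mem _
  rw [← gradedProj_of_mem (L.isInternal n) hy]
  exact key y

end LinearResolution

/-! ### Koszulity forces `fⁿᵢ` to have length `n` -/

namespace DefinesMinimalResolution

variable {k : Type u} [Field k] {V : Type v} [Quiver.{w} V] [Fintype V]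
  {I : Ideal (PathAlgebra k V)} [I.IsTwoSided] {s : ℕ → ℕ} {f : ∀ n, Fin (s n) → PathAlgebra k V}
  (h : DefinesMinimalResolution I f) (L : LinearResolution I)

theorem map_mem_rad {M N : Type*} [AddCommGroup M] [Module (Lam I)ᵐᵒᵖ M] [AddCommGroup N]
    [Module (Lam I)ᵐᵒᵖ N] (g : M →ₗ[(Lam I)ᵐᵒᵖ] N) {x : M}
    (hx : x ∈ Submodule.span (Lam I)ᵐᵒᵖ {z : M | ∃ a ∈ rad I, ∃ y, z = op a • y}) :
    g x ∈ Submodule.span (Lam I)ᵐᵒᵖ {z : N | ∃ a ∈ rad I, ∃ y, z = op a • y} := by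
  refine (Submodule.map_span_le g _ _).2 ?_ (Submodule.mem_map_of_mem hx)
  rintro _ ⟨a, ha, y, rfl⟩
  exact Submodule.subset_span ⟨a, ha, g y, map_smul g _ _⟩

/-- The homomorphism `φ' : Fⁿ → Pⁿ` of degree zero such that `φ' (fⁿᵢ)` is the homogeneous component
of `φ (fⁿᵢ)` whose degree is the length of `fⁿᵢ`. -/
def homogenize {n : ℕ} (φ : FTerm I f n →ₗ[(Lam I)ᵐᵒᵖ] L.P n) : FTerm I f n →ₗ[(Lam I)ᵐᵒᵖ] L.P n :=
  h.lift fun i => L.proj n (h.deg n i) (φ (fbar I f n i))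

theorem homogenize_fbar {n : ℕ} (φ : FTerm I f n →ₗ[(Lam I)ᵐᵒᵖ] L.P n) (i : Fin (s n)) :
    h.homogenize L φ (fbar I f n i) = L.proj n (h.deg n i) (φ (fbar I f n i)) := by
  rw [homogenize, lift_fbar, ← L.proj_smul _ _ (h.term_mem n i), add_zero, ← map_smul,
    fbar_smul_term]

/-- The coefficient of `x` at `fⁿᵢ` has length `d - deg fⁿᵢ`, and acting by it shifts degrees by
just that amount. No grading on `Fⁿ` is needed: degrees are measured on representatives in `kQ`. -/
theorem homogenize_toF {n d : ℕ} (φ : FTerm I f n →ₗ[(Lam I)ᵐᵒᵖ] L.P n) (x : rightSpan f n)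
    (hx : (x : PathAlgebra k V) ∈ lengthPart k V d) :
    h.homogenize L φ (toF I f n x) = L.proj n d (φ (toF I f n x)) := by
  rw [h.toF_eq_sum, map_sum, map_sum, map_sum]
  refine Finset.sum_congr rfl fun i _ => ?_
  rw [map_smul, homogenize_fbar, map_smul]
  by_cases hi : h.deg n i ≤ d
  · rw [← L.proj_smul _ _ (h.coord_mem_lengthPart hx i), Nat.add_sub_cancel' hi]
  · rw [h.coord_eq_zero_of_lt hx i (not_le.1 hi)]
    simp

/-- The differential sends the class of `fⁿ⁺¹ᵢ` to the class of the same element of `kQ`, which is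
homogeneous of the same length, so `homogenize_toF` applies to it. -/
theorem homogenize_diff {n : ℕ} (φ : FTerm I f n →ₗ[(Lam I)ᵐᵒᵖ] L.P n)
    (ψ : FTerm I f (n + 1) →ₗ[(Lam I)ᵐᵒᵖ] L.P (n + 1))
    (hφ : L.d n ∘ₗ ψ = φ ∘ₗ diff I (h.le n)) :
    L.d n ∘ₗ h.homogenize L ψ = h.homogenize L φ ∘ₗ diff I (h.le n) := by
  refine h.hom_ext fun i => ?_
  have h1 := LinearMap.congr_fun hφ (fbar I f (n + 1) i)
  simp only [LinearMap.comp_apply] at h1 ⊢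
  rw [homogenize_fbar, ← L.proj_d, h1, ← toF_gen, diff_toF]
  exact (h.homogenize_toF L φ _ (h.mem_deg (n + 1) i)).symm

theorem aug_homogenize (φ : FTerm I f 0 →ₗ[(Lam I)ᵐᵒᵖ] L.P 0) :
    L.aug ∘ₗ h.homogenize L φ = L.aug ∘ₗ φ := by
  refine h.hom_ext fun i => ?_
  simp only [LinearMap.comp_apply]
  rw [homogenize_fbar, deg_zero, L.aug_proj_zero]

/-- A lift of the identity of `Λ / 𝔯`. -/
def toLinear : h.resolution.complex ⟶ L.resolution.complex :=
  ProjectiveResolution.lift (𝟙 (modRad I)) h.resolution L.resolution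

/-- The components of `toLinear`. -/
def toLinearHom (n : ℕ) : FTerm I f n →ₗ[(Lam I)ᵐᵒᵖ] L.P n :=
  ((h.toLinear L).f n).hom

/-- A lift of the identity of `Λ / 𝔯` whose components have degree zero. -/
def toLinearHomogeneous : h.resolution.complex ⟶ L.resolution.complex :=
  ChainComplex.ofHom (fun n => ModuleCat.ofHom (h.homogenize L (h.toLinearHom L n))) (fun n => by
    have h1 := (h.toLinear L).comm (n + 1) n
    have h2 : L.d n ∘ₗ h.toLinearHom L (n + 1) = h.toLinearHom L n ∘ₗ diff I (h.le n) := by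
      have e1 : h.resolution.complex.d (n + 1) n = ModuleCat.ofHom (diff I (h.le n)) :=
        h.complex_d n
      have e2 : L.resolution.complex.d (n + 1) n = ModuleCat.ofHom (L.d n) := L.complex_d n
      rw [e1, e2] at h1
      exact congrArg ModuleCat.Hom.hom h1
    have h3 := h.homogenize_diff L _ _ h2
    refine (congrArg (_ ≫ ·) (L.complex_d n)).trans
      (Eq.trans ?_ (congrArg (· ≫ _) (h.complex_d n)).symm)
    exact congrArg ModuleCat.ofHom h3)

theorem toLinearHomogeneous_π :
    h.toLinearHomogeneous L ≫ L.resolution.π =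
      h.resolution.π ≫ (ChainComplex.single₀ _).map (𝟙 _) := by
  rw [← ProjectiveResolution.lift_commutes (𝟙 (modRad I)) h.resolution L.resolution]
  refine (ChainComplex.toSingle₀Equiv _ _).injective (Subtype.ext ?_)
  have e1 : L.resolution.π.f 0 = ModuleCat.ofHom L.aug :=
    ChainComplex.toSingle₀Equiv_symm_apply_f_zero _ _
  change (h.toLinearHomogeneous L).f 0 ≫ L.resolution.π.f 0 =
    (h.toLinear L).f 0 ≫ L.resolution.π.f 0
  rw [e1]
  exact congrArg ModuleCat.ofHom (h.aug_homogenize L (h.toLinearHom L 0))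

/-- If the length were not `n`, the degree zero comparison map would send the generator to `Pⁿ𝔯`, as
`Pⁿ` is generated in degree `n`. The round trip through `P` differs from the identity by homotopy
terms with values in `Fⁿ𝔯`, so the generator itself would lie in `Fⁿ𝔯`. -/
theorem deg_eq_self (L : LinearResolution I) (hI : I ≤ arrowIdeal k V) (n : ℕ) (i : Fin (s n)) : h.deg n i = n := by
  by_contra hne
  let ψ := ProjectiveResolution.lift (𝟙 (modRad I)) L.resolution h.resolution
  let H : Homotopy (h.toLinearHomogeneous L ≫ ψ) (𝟙 _) :=
    ProjectiveResolution.liftHomotopy (𝟙 (modRad I)) _ _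
      (by rw [Category.assoc, ProjectiveResolution.lift_commutes, ← Category.assoc,
        toLinearHomogeneous_π, Category.assoc, ← Functor.map_comp, Category.id_comp])
      (by simp)
  have h1 := H.comm n
  have hφ : h.homogenize L (h.toLinearHom L n) (fbar I f n i) ∈
      Submodule.span (Lam I)ᵐᵒᵖ {z : L.P n | ∃ a ∈ rad I, ∃ y, z = op a • y} := by
    rw [homogenize_fbar]
    exact L.mem_rad_of_mem_gr hne (gradedProj_mem _ _ _)
  have hd : ∀ m, h.resolution.complex.d (m + 1) m = ModuleCat.ofHom (diff I (h.le m)) :=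
    h.complex_d
  let A : FTerm I f n →ₗ[(Lam I)ᵐᵒᵖ] FTerm I f n := (prevD n H.hom).hom
  let B : FTerm I f n →ₗ[(Lam I)ᵐᵒᵖ] FTerm I f n := (dNext n H.hom).hom
  let C : L.P n →ₗ[(Lam I)ᵐᵒᵖ] FTerm I f n := (ψ.f n).hom
  -- Each homotopy term contains one differential of `F`: in `A` it is applied last, in `B` first.
  -- Minimality handles `A` directly, and `B` because homomorphisms preserve multiples of `𝔯`.
  have hprev : ∀ x, A x ∈
      Submodule.span (Lam I)ᵐᵒᵖ {z : FTerm I f n | ∃ a ∈ rad I, ∃ y, z = op a • y} := by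
    intro x
    simp only [A]
    rw [Homotopy.prevD_chainComplex, hd]
    exact h.minimal n _
  have hnext : ∀ x, B x ∈
      Submodule.span (Lam I)ᵐᵒᵖ {z : FTerm I f n | ∃ a ∈ rad I, ∃ y, z = op a • y} := by
    intro x
    cases n with
    | zero =>
      simp only [B]
      rw [Homotopy.dNext_zero_chainComplex]
      exact zero_mem _
    | succ n =>
      simp only [B]
      rw [Homotopy.dNext_succ_chainComplex, hd]
      exact map_mem_rad (N := FTerm I f (n + 1)) (H.hom n (n + 1)).hom (h.minimal n x)
  have h2 : C (h.homogenize L (h.toLinearHom L n) (fbar I f n i)) =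
      B (fbar I f n i) + A (fbar I f n i) + fbar I f n i :=
    congrArg (fun g : h.resolution.complex.X n ⟶ h.resolution.complex.X n =>
      (g.hom (fbar I f n i) : FTerm I f n)) h1
  refine h.fbar_notMem_rad hI n i ?_
  rw [← sub_eq_of_eq_add' h2]
  exact sub_mem (map_mem_rad C hφ) (add_mem (hnext _) (hprev _))

theorem mem_lengthPart (h : DefinesMinimalResolution I f) (L : LinearResolution I) (hI : I ≤ arrowIdeal k V) (n : ℕ)
    (i : Fin (s n)) : f n i ∈ lengthPart k V n := by
  have := h.mem_deg n i
  rwa [h.deg_eq_self L hI] at this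

/-! ### Expansion of the `fⁿᵢ` -/

/-- Exactness at `Fⁿ⁺¹`, read in `kQ`: membership in `∐ᵢ fⁿᵢ I` says that the class of `x` is a
cycle. -/
theorem exists_sub_mem_rightSpanI (h : DefinesMinimalResolution I f) {n : ℕ} {x : PathAlgebra k V}
    (hx : x ∈ rightSpan f (n + 1)) (hx' : x ∈ rightSpanI I f n) :
    ∃ y ∈ rightSpan f (n + 2), x - y ∈ rightSpanI I f (n + 1) := by
  have h1 : diff I (h.le n) (toF I f (n + 1) ⟨x, hx⟩) = 0 := by
    rw [diff_toF, toF_eq_zero_iff]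
    exact hx'
  obtain ⟨y, hy⟩ := (h.exact_succ n _).1 h1
  obtain ⟨y, rfl⟩ := toF_surjective I f _ y
  refine ⟨y, y.2, ?_⟩
  rw [diff_toF, eq_comm, ← sub_eq_zero, ← map_sub, toF_eq_zero_iff] at hy
  exact hy

theorem exists_sub_mem_rightSpanI_zero (h : DefinesMinimalResolution I f)
    (hI : I ≤ arrowIdeal k V) {x : PathAlgebra k V}
    (hx : x ∈ arrowIdeal k V) : ∃ y ∈ rightSpan f 1, x - y ∈ rightSpanI I f 0 := by
  have h1 : aug I f (toF I f 0 ⟨x, h.eq_top ▸ Submodule.mem_top⟩) = 0 := by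
    rw [aug_toF, toModRad_eq_zero_iff hI]
    exact hx
  obtain ⟨y, hy⟩ := (h.exact_zero _).1 h1
  obtain ⟨y, rfl⟩ := toF_surjective I f _ y
  refine ⟨y, y.2, ?_⟩
  rw [diff_toF, eq_comm, ← sub_eq_zero, ← map_sub, toF_eq_zero_iff] at hy
  exact hy

theorem rightSpan_le_rightSpanI (h : DefinesMinimalResolution I f) {n : ℕ} {x : PathAlgebra k V}
    (hx : x ∈ rightSpan f (n + 2)) : x ∈ rightSpanI I f n := by
  have h1 := (h.exact_succ n).apply_apply_eq_zero (toF I f (n + 2) ⟨x, hx⟩)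
  rwa [diff_toF, diff_toF, toF_eq_zero_iff] at h1

theorem rightSpan_add_le (h : DefinesMinimalResolution I f) (r m : ℕ) :
    rightSpan f (r + m) ≤ rightSpan f r := by
  induction m with
  | zero => exact le_rfl
  | succ m ih => exact (h.le (r + m)).trans ih

/-- The coefficient of `fʳₚ` in an element of `∐ᵢ fʳ⁺ᵐᵢ R`. -/
def coordAdd (r m : ℕ) (p : Fin (s r)) :
    rightSpan f (r + m) →ₗ[(PathAlgebra k V)ᵐᵒᵖ] PathAlgebra k V :=
  h.coord r p ∘ₗ Submodule.inclusion (h.rightSpan_add_le r m)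

theorem coordAdd_mem {r m : ℕ} {p : Fin (s r)}
    (hgen : ∀ l, h.coordAdd r m p (gen f (r + m) l) ∈ rightSpan f m) (x : rightSpan f (r + m)) :
    h.coordAdd r m p x ∈ rightSpan f m := by
  rw [← h.sum_gen_smul x, map_sum]
  refine sum_mem fun l _ => ?_
  rw [map_smul]
  exact Submodule.smul_mem _ _ (hgen l)

/-- The coefficients of `x` at the `fʳ⁺ᵐ_l` lie in `I`, and by right linearity they can be pulled
out of `coordAdd`. -/
theorem coordAdd_mem_rightSpanI {r m : ℕ} {p : Fin (s r)}
    (hm : ∀ x, h.coordAdd r m p x ∈ rightSpan f m) {x : rightSpan f (r + m)}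
    (hx : (x : PathAlgebra k V) ∈ rightSpanI I f (r + m)) :
    h.coordAdd r m p x ∈ rightSpanI I f m := by
  rw [← h.sum_gen_smul x, map_sum]
  refine sum_mem fun l _ => ?_
  rw [map_smul]
  exact mul_mem_rightSpanI I f (hm _) (h.coord_mem hx l)

theorem lengthComponent_eq_zero_of_mem_rightSpanI (hI : I ≤ arrowIdeal k V ^ 2)
    {m : ℕ} (hf : ∀ i, f m i ∈ lengthPart k V m)
    {x : PathAlgebra k V} (hx : x ∈ rightSpanI I f m) : lengthComponent k V (m + 1) x = 0 := by
  obtain ⟨a, ha, rfl⟩ := exists_mem_of_mem_rightSpanI hx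
  rw [map_sum]
  refine Finset.sum_eq_zero fun i _ => ?_
  rw [lengthComponent_mul (hf i), lengthComponent_one_of_mem_arrowIdeal_sq (hI (ha i)), mul_zero]

/-- The error `x - y` has no component of length `m + 1`, because `fᵐᵢ` has length `m` and elements
of `I ⊆ J²` have no component of length one. So `x` equals the component of `y` of that length. -/
theorem mem_rightSpan_of_sub_mem (h : DefinesMinimalResolution I f) (hI : I ≤ arrowIdeal k V ^ 2)
    {m : ℕ} (hf : ∀ i, f m i ∈ lengthPart k V m) {x y : PathAlgebra k V}
    (hx : x ∈ lengthPart k V (m + 1)) (hy : y ∈ rightSpan f (m + 1))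
    (hxy : x - y ∈ rightSpanI I f m) : x ∈ rightSpan f (m + 1) := by
  have h1 := lengthComponent_eq_zero_of_mem_rightSpanI hI hf hxy
  rw [map_sub, lengthComponent_of_mem hx, sub_eq_zero] at h1
  rw [h1]
  exact h.lengthComponent_mem_rightSpan ⟨y, hy⟩ _

theorem coordAdd_gen_mem_lengthPart (hf : ∀ n i, f n i ∈ lengthPart k V n) (r m : ℕ)
    (p : Fin (s r)) (l : Fin (s (r + m))) :
    h.coordAdd r m p (gen f (r + m) l) ∈ lengthPart k V m := by
  have := h.coord_mem_lengthPart (n := r) (d := r + m)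
    (x := Submodule.inclusion (h.rightSpan_add_le r m) (gen f (r + m) l)) (hf (r + m) l) p
  rwa [h.deg_eq (hf r p), Nat.add_sub_cancel_left] at this

/-- This is the core of the expansion. Right linearity reduces it to the generators `fʳ⁺ᵐ_l`, whose
coefficients are homogeneous of length `m`; exactness of `F` then places these in `∐ fᵐ R` up to an
error that the length excludes. -/
theorem coordAdd_mem_rightSpan (hI : I ≤ arrowIdeal k V ^ 2)
    (hf : ∀ n i, f n i ∈ lengthPart k V n) (r m : ℕ) (p : Fin (s r)) (x : rightSpan f (r + m)) :
    h.coordAdd r m p x ∈ rightSpan f m := by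
  induction m using Nat.strong_induction_on with
  | _ m ih =>
    match m, ih with
    | 0, _ => exact h.eq_top ▸ Submodule.mem_top
    -- The coefficient has length one, hence lies in `J`; exactness at `F⁰` replaces exactness at a
    -- later term.
    | 1, _ =>
      refine h.coordAdd_mem (fun l => ?_) x
      have h1 := h.coordAdd_gen_mem_lengthPart hf r 1 p l
      obtain ⟨y, hy, hxy⟩ := h.exists_sub_mem_rightSpanI_zero (hI.trans arrowIdeal_sq_le)
        (lengthPart_succ_le_arrowIdeal one_ne_zero h1)
      exact h.mem_rightSpan_of_sub_mem hI (hf 0) h1 hy hxy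
    | m + 2, ih =>
      refine h.coordAdd_mem (fun l => ?_) x
      have h1 := h.coordAdd_gen_mem_lengthPart hf r (m + 2) p l
      -- By `h2` the coefficient represents an element of `Fᵐ⁺¹`. By `h3` this is a cycle: the
      -- generator lies in `∐ fʳ⁺ᵐ I`, as two successive differentials compose to zero, and taking
      -- coefficients carries this to `∐ fᵐ I`.
      have h2 := ih (m + 1) (by omega) ⟨_, h.le (r + (m + 1)) (gen f (r + (m + 2)) l).2⟩
      have h3 := h.coordAdd_mem_rightSpanI (ih m (by omega))
        (x := ⟨_, h.le _ (h.le _ (gen f (r + (m + 2)) l).2)⟩)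
        (h.rightSpan_le_rightSpanI (gen f (r + (m + 2)) l).2)
      obtain ⟨y, hy, hxy⟩ := h.exists_sub_mem_rightSpanI h2 h3
      exact h.mem_rightSpan_of_sub_mem hI (hf (m + 1)) h1 hy hxy

theorem sum_coordAdd (r m : ℕ) (x : rightSpan f (r + m)) :
    ∑ p, f r p * h.coordAdd r m p x = x :=
  h.sum_coord (Submodule.inclusion (h.rightSpan_add_le r m) x)

/-- The coefficients have length zero and start at the terminal vertex of `fⁿᵢ`, so they are scalar
multiples of it. -/
theorem exists_smul_of_mem_lengthPart (h : DefinesMinimalResolution I f)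
    (hf : ∀ n i, f n i ∈ lengthPart k V n) {n : ℕ}
    (x : rightSpan f n) (hx : (x : PathAlgebra k V) ∈ lengthPart k V n) :
    ∃ c : Fin (s n) → k, (x : PathAlgebra k V) = ∑ i, c i • f n i := by
  have h1 : ∀ i, ∃ c : k, h.coord n i x = c • h.term n i := fun i => by
    have h2 := h.coord_mem_lengthPart hx i
    rw [h.deg_eq (hf n i), Nat.sub_self] at h2
    obtain ⟨c, hc⟩ := lengthPart_zero_eq_smul_vertex h2 (h.uniform n i).terminus
    exact ⟨c, by rw [← term_mul_coord]; exact hc⟩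
  choose c hc using h1
  refine ⟨c, ?_⟩
  conv_lhs => rw [← h.sum_coord x]
  refine Finset.sum_congr rfl fun i _ => ?_
  rw [hc, mul_smul_comm, mul_term]

theorem exists_isComultiplicative (h : DefinesMinimalResolution I f) (hI : I ≤ arrowIdeal k V ^ 2)
    (hf : ∀ n i, f n i ∈ lengthPart k V n) : ∃ c, IsComultiplicative (k := k) f c := by
  classical
  have h1 : ∀ r t (i : Fin (s (r + t))) (p : Fin (s r)), ∃ c : Fin (s t) → k,
      h.coordAdd r t p (gen f (r + t) i) = ∑ q, c q • f t q := fun r t i p =>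
    h.exists_smul_of_mem_lengthPart hf ⟨_, h.coordAdd_mem_rightSpan hI hf r t p (gen f (r + t) i)⟩
      (h.coordAdd_gen_mem_lengthPart hf r t p i)
  choose c hc using h1
  -- Resetting the scalars of vanishing products to zero normalizes them and leaves the sum
  -- unchanged.
  refine ⟨fun r t i p q => if f r p * f t q = 0 then 0 else c r t i p q, ⟨fun r t i => ?_,
    fun r t i p q hpq => if_pos hpq⟩⟩
  have h2 := h.sum_coordAdd r t (gen f (r + t) i)
  rw [show f (r + t) i = _ from h2.symm]
  refine Finset.sum_congr rfl fun p _ => ?_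
  rw [hc, Finset.mul_sum]
  refine Finset.sum_congr rfl fun q _ => ?_
  rw [mul_smul_comm]
  split_ifs with hpq
  · rw [hpq, smul_zero, zero_smul]
  · rfl

/-! ### Division by `fⁿⱼ` -/

theorem term_mul (n m : ℕ) (j : Fin (s n)) (i : Fin (s m)) :
    h.term n j * f m i = f m i ∨ f n j * f m i = 0 := by
  obtain ⟨u, v, huv⟩ := (h.uniform m i).2
  by_cases hu : (h.uniform n j).terminus = u
  · left
    rw [huv, term, hu, ← mul_assoc, ← mul_assoc, vertex_mul_vertex]
  · right
    rw [← h.mul_term n j, huv, mul_assoc, term, ← mul_assoc (vertex _), ← mul_assoc (vertex _),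
      vertex_mul_vertex_of_ne hu, zero_mul, zero_mul, mul_zero]

variable {c : ∀ r t : ℕ, Fin (s (r + t)) → Fin (s r) → Fin (s t) → k}

/-- The coefficient is a priori `t(fⁿⱼ)` times this sum. The vertex fixes `fʳᵢ` unless `fⁿⱼ fʳᵢ =
0`, and in that case normalization makes the scalar zero. -/
theorem coordAdd_gen (hc : IsComultiplicative f c) (n r : ℕ) (j : Fin (s n))
    (l : Fin (s (n + r))) :
    h.coordAdd n r j (gen f (n + r) l) = ∑ i, c n r l j i • f r i := by
  have h1 := h.coord_eq (x := Submodule.inclusion (h.rightSpan_add_le n r) (gen f (n + r) l))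
    (a := fun p => ∑ i, c n r l p i • f r i) (by
      refine (hc.expand n r l).trans (Finset.sum_congr rfl fun p _ => ?_)
      rw [Finset.mul_sum]
      exact Finset.sum_congr rfl fun q _ => (mul_smul_comm _ _ _).symm) j
  refine h1.trans ?_
  rw [Finset.mul_sum]
  refine Finset.sum_congr rfl fun i _ => ?_
  rw [mul_smul_comm]
  obtain h2 | h2 := h.term_mul n r j i
  · rw [h2]
  · rw [hc.normalized n r l j i h2, zero_smul, zero_smul]

theorem smul_eq_smul (c : k) (x : PathAlgebra k V) :
    c • x = op (algebraMap k (PathAlgebra k V) c) • x := by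
  rw [Algebra.smul_def, Algebra.commutes]
  rfl

theorem coordAdd_mem_of_isComultiplicative (hc : IsComultiplicative f c) (n r : ℕ) (j : Fin (s n))
    (x : rightSpan f (n + r)) : h.coordAdd n r j x ∈ rightSpan f r := by
  refine h.coordAdd_mem (fun l => ?_) x
  rw [h.coordAdd_gen hc]
  refine sum_mem fun i _ => ?_
  rw [smul_eq_smul]
  exact Submodule.smul_mem _ _ (Submodule.subset_span ⟨i, rfl⟩)

/-- A non-zero constant forces `fᵐᵢ` and `fⁿ⁺ᵐ_l` to end at the same vertex, since taking
coefficients commutes with right multiplication by the terminal vertex of `fⁿ⁺ᵐ_l`. In the product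
formula the dual of `fᵐᵢ` yields the former vertex, while the dual of `fⁿ⁺ᵐ_l` requires the latter.
-/
theorem smul_term_eq (hc : IsComultiplicative f c) (n m : ℕ) (j : Fin (s n)) (i : Fin (s m))
    (l : Fin (s (n + m))) : c n m l j i • h.term m i = c n m l j i • h.term (n + m) l := by
  have h1 : h.coordAdd n m j (gen f (n + m) l) * h.term (n + m) l =
      h.coordAdd n m j (gen f (n + m) l) := by
    have h2 : op (h.term (n + m) l) • gen f (n + m) l = gen f (n + m) l :=
      Subtype.ext (h.mul_term _ l)
    conv_rhs => rw [← h2, map_smul]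
    rfl
  rw [h.coordAdd_gen hc, Finset.sum_mul] at h1
  have h3 := h.term_mul_eq (n := m) (a := fun i => c n m l j i • h.term (n + m) l)
    (b := fun i => c n m l j i • h.term m i) (by
      simp only [mul_smul_comm, mul_term]
      rw [← h1]
      exact Finset.sum_congr rfl fun q _ => (smul_mul_assoc _ _ _).symm) i
  simp only [mul_smul_comm, term_mul_term] at h3
  rw [← h3]
  by_cases hv : (h.uniform m i).terminus = (h.uniform (n + m) l).terminus
  · simp only [term, hv, vertex_mul_vertex]
  · rw [term, term, vertex_mul_vertex_of_ne hv, smul_zero] at h3 ⊢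
    have : c n m l j i = 0 := (smul_eq_zero.1 h3.symm).resolve_right (vertex_ne_zero _)
    rw [this, zero_smul]

/-- The map `∐ᵢ fⁿ⁺ʳᵢ R → ∐ᵢ fʳᵢ R` that takes the coefficient of `fⁿⱼ`. -/
def divide (hc : IsComultiplicative f c) (n r : ℕ) (j : Fin (s n)) :
    rightSpan f (n + r) →ₗ[(PathAlgebra k V)ᵐᵒᵖ] rightSpan f r :=
  (h.coordAdd n r j).codRestrict _ (h.coordAdd_mem_of_isComultiplicative hc n r j)

/-- The lift `Fⁿ⁺ʳ → Fʳ` of the homomorphism dual to `fⁿⱼ`. -/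
def liftDual (hc : IsComultiplicative f c) (n r : ℕ) (j : Fin (s n)) :
    FTerm I f (n + r) →ₗ[(Lam I)ᵐᵒᵖ] FTerm I f r :=
  h.lift fun l => toF I f r (h.divide hc n r j (gen f (n + r) l))

theorem liftDual_toF (hc : IsComultiplicative f c) (n r : ℕ) (j : Fin (s n))
    (x : rightSpan f (n + r)) :
    h.liftDual hc n r j (toF I f (n + r) x) = toF I f r (h.divide hc n r j x) := by
  rw [liftDual, lift_toF]
  conv_rhs => rw [← h.sum_gen_smul x, map_sum, map_sum]
  refine Finset.sum_congr rfl fun l _ => ?_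
  rw [map_smul, map_smul]
  rfl

/-- The differentials are induced by inclusions, and the coefficient of `fⁿⱼ` in an element of `kQ`
does not depend on which `∐ fⁿ⁺ʳ R` it is taken from. So the squares commute strictly and without
signs. -/
theorem liftDual_diff (hc : IsComultiplicative f c) (n r : ℕ) (j : Fin (s n)) :
    h.liftDual hc n r j ∘ₗ diff I (h.le (n + r)) =
      diff I (h.le r) ∘ₗ h.liftDual hc n (r + 1) j := by
  ext x
  obtain ⟨x, rfl⟩ := toF_surjective I f _ x
  simp only [LinearMap.comp_apply]
  rw [diff_toF, liftDual_toF]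
  have := h.liftDual_toF hc n (r + 1) j x
  exact (congrArg (diff I (h.le r)) this).symm

theorem aug_liftDual (hc : IsComultiplicative f c) (n : ℕ) (j : Fin (s n)) :
    aug I f ∘ₗ h.liftDual hc n 0 j = h.dual n j := by
  refine h.hom_ext (n := n) fun i => ?_
  rw [dual_fbar, LinearMap.comp_apply]
  have h1 := h.liftDual_toF hc n 0 j (gen f n i)
  refine (congrArg (aug I f) h1).trans ((aug_toF I f _).trans ?_)
  have h2 := h.coord_gen n j i
  refine (congrArg (toModRad I) h2).trans ?_
  split_ifs
  · rfl
  · exact map_zero _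

theorem liftDual_fbar (hc : IsComultiplicative f c) (n r : ℕ) (j : Fin (s n))
    (l : Fin (s (n + r))) : h.liftDual hc n r j (fbar I f (n + r) l) =
      ∑ i, op (Ideal.Quotient.mk I (algebraMap k _ (c n r l j i))) • fbar I f r i := by
  rw [← toF_gen, liftDual_toF]
  have : h.divide hc n r j (gen f (n + r) l) =
      ∑ i, op (algebraMap k (PathAlgebra k V) (c n r l j i)) • gen f r i := by
    refine Subtype.ext ?_
    rw [AddSubmonoidClass.coe_finsetSum]
    refine (h.coordAdd_gen hc n r j l).trans (Finset.sum_congr rfl fun i _ => ?_)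
    rw [smul_eq_smul]
    rfl
  rw [this, map_sum]
  refine Finset.sum_congr rfl fun i _ => ?_
  rw [map_smul]
  rfl

end DefinesMinimalResolution

/-! ### Cocycles and their classes in `Ext` -/

section ExtMk

open CochainComplex HomComplex

variable {C : Type u} [Category.{v} C] [Abelian C] [HasExt.{w} C] {X Y : C}
  (R : ProjectiveResolution X)

theorem extMk_zero_injective (φ : R.complex.X 0 ⟶ Y) (hφ : R.complex.d 1 0 ≫ φ = 0)
    (h : R.extMk φ 1 rfl hφ = 0) : φ = 0 := by
  rw [← R.extEquivCohomologyClass.apply_eq_iff_eq,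
    ProjectiveResolution.extEquivCohomologyClass_extMk,
    ProjectiveResolution.extEquivCohomologyClass_zero, CohomologyClass.mk_eq_zero_iff,
    Cocycle.toSingleMk_mem_coboundaries_iff _ _ _ _ _ 1 (by lia)] at h
  obtain ⟨g, hg⟩ := h
  -- A coboundary in degree zero factors through the term of the resolution in cohomological degree
  -- `1`, which is zero.
  rw [(CochainComplex.isZero_of_isStrictlyLE R.cochainComplex 0 1 (by omega)).eq_of_src g 0,
    Limits.comp_zero] at hg
  rw [← cancel_epi (R.cochainComplexXIso (-(0 : ℕ)) 0 rfl).hom, ← hg, Limits.comp_zero]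

theorem smul_extMk {k : Type*} [Field k] [Linear k C] {n : ℕ} (c : k) (φ : R.complex.X n ⟶ Y)
    (hφ : R.complex.d (n + 1) n ≫ φ = 0) (hcφ : R.complex.d (n + 1) n ≫ (c • φ) = 0) :
    c • R.extMk φ (n + 1) rfl hφ = R.extMk (c • φ) (n + 1) rfl hcφ := by
  rw [Abelian.Ext.smul_eq_comp_mk₀, ProjectiveResolution.extMk_comp_mk₀]
  congr 1
  simp

end ExtMk

/-! ### The dual basis of `Ext` and the product formula -/

namespace DefinesMinimalResolution

variable {k : Type u} [Field k] {V : Type v} [Quiver.{w} V] [Fintype V]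
  {I : Ideal (PathAlgebra k V)} [I.IsTwoSided] {s : ℕ → ℕ} {f : ∀ n, Fin (s n) → PathAlgebra k V}
  (h : DefinesMinimalResolution I f)

instance homModule (M N : ModuleCat.{max u v w} (Lam I)ᵐᵒᵖ) : Module k (M ⟶ N) :=
  Linear.homModule M N

instance homSMul (M N : ModuleCat.{max u v w} (Lam I)ᵐᵒᵖ) : SMul k (M ⟶ N) :=
  (homModule M N).toSMul

theorem d_comp (n : ℕ) (φ : h.resolution.complex.X n ⟶ modRad I) :
    h.resolution.complex.d (n + 1) n ≫ φ = 0 := by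
  refine (congrArg (· ≫ φ) (h.complex_d n)).trans ?_
  ext x
  exact h.map_diff φ.hom x

theorem d_comp_comp (n : ℕ) {M : ModuleCat (Lam I)ᵐᵒᵖ} (g : h.resolution.complex.X n ⟶ M)
    (φ : M ⟶ modRad I) : h.resolution.complex.d (n + 1) n ≫ g ≫ φ = 0 :=
  h.d_comp n (g ≫ φ)

/-- The isomorphism of `Hom(Fⁿ, Λ / 𝔯)` with `Extⁿ(Λ / 𝔯, Λ / 𝔯)`. -/
def extEquiv (n : ℕ) :
    (h.resolution.complex.X n ⟶ modRad I) ≃ₗ[k] Abelian.Ext (modRad I) (modRad I) n :=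
  LinearEquiv.ofBijective
    { toFun := fun φ => h.resolution.extMk φ (n + 1) rfl (h.d_comp n φ)
      map_add' := fun φ ψ => (ProjectiveResolution.add_extMk _ _ _ _ _ _ _).symm
      map_smul' := fun c φ => (smul_extMk _ _ _ _ _).symm } (by
    constructor
    · rw [injective_iff_map_eq_zero]
      intro φ hφ
      change h.resolution.extMk φ (n + 1) rfl (h.d_comp n φ) = 0 at hφ
      cases n with
      | zero => exact extMk_zero_injective _ _ _ hφ
      | succ n =>
        rw [ProjectiveResolution.extMk_eq_zero_iff _ _ _ _ _ n rfl] at hφ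
        obtain ⟨g, rfl⟩ := hφ
        -- A coboundary is a differential followed by some `g : Fⁿ → Λ/𝔯`, and by minimality this
        -- composite is zero.
        exact h.d_comp n g
    · intro a
      obtain ⟨φ, hφ, rfl⟩ := h.resolution.extMk_surjective a (n + 1) rfl
      exact ⟨φ, rfl⟩)

/-- A homomorphism `Fⁿ → Λ / 𝔯`, as a morphism. -/
def toHom {n : ℕ} (φ : FTerm I f n →ₗ[(Lam I)ᵐᵒᵖ] ModRad I) :
    h.resolution.complex.X n ⟶ modRad I :=
  ModuleCat.ofHom φ

theorem extEquiv_toHom {n : ℕ} (φ : FTerm I f n →ₗ[(Lam I)ᵐᵒᵖ] ModRad I) :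
    h.extEquiv n (h.toHom φ) = h.extClass φ := rfl

/-- The value of a morphism at `fⁿᵢ`. -/
def eval {n : ℕ} (i : Fin (s n)) : (h.resolution.complex.X n ⟶ modRad I) →+ ModRad I where
  toFun φ := φ.hom (fbar I f n i)
  map_zero' := rfl
  map_add' _ _ := rfl

theorem eval_smul {n : ℕ} (i : Fin (s n)) (c : k) (φ : h.resolution.complex.X n ⟶ modRad I) :
    h.eval i (c • φ) = op (Ideal.Quotient.mk I (algebraMap k _ c)) • h.eval i φ := rfl

theorem eval_toHom {n : ℕ} (i : Fin (s n)) (φ : FTerm I f n →ₗ[(Lam I)ᵐᵒᵖ] ModRad I) :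
    h.eval i (h.toHom φ) = φ (fbar I f n i) := rfl

theorem eval_ext {n : ℕ} {φ ψ : h.resolution.complex.X n ⟶ modRad I}
    (H : ∀ i, h.eval i φ = h.eval i ψ) : φ = ψ :=
  ModuleCat.hom_ext (h.hom_ext (φ := φ.hom) (ψ := ψ.hom) H)

theorem smul_toModRad (c : k) (x : PathAlgebra k V) :
    op (Ideal.Quotient.mk I (algebraMap k _ c)) • toModRad I x = toModRad I (c • x) := by
  rw [← toModRad_smul, Algebra.smul_def, Algebra.commutes]

theorem eval_sum_dual {n : ℕ} (c : Fin (s n) → k) (j : Fin (s n)) :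
    h.eval j (∑ i, c i • h.toHom (h.dual n i)) = toModRad I (c j • h.term n j) := by
  rw [map_sum, Finset.sum_eq_single j]
  · rw [eval_smul, eval_toHom, dual_fbar, if_pos rfl, smul_toModRad]
  · intro i _ hi
    rw [eval_smul, eval_toHom, dual_fbar, if_neg hi, smul_zero]
  · simp

theorem linearIndependent_dual (hI : I ≤ arrowIdeal k V) (n : ℕ) :
    LinearIndependent k fun i => h.toHom (h.dual n i) := by
  rw [Fintype.linearIndependent_iff]
  intro c hc j
  have h1 := h.eval_sum_dual c j
  rw [hc, map_zero, eq_comm, toModRad_eq_zero_iff hI] at h1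
  by_contra hj
  have h2 := Ideal.mul_mem_left _ (algebraMap k _ (c j)⁻¹) h1
  rw [← Algebra.smul_def, inv_smul_smul₀ hj] at h2
  exact vertex_notMem_arrowIdeal _ h2

/-- The value of `φ` at the class of `fⁿᵢ` is fixed by `t(fⁿᵢ)`, so it is the class of some `y
t(fⁿᵢ)`. Modulo `J` only the component of `y` of length zero counts, which leaves a scalar multiple
of the vertex. -/
theorem top_le_span_dual (hI : I ≤ arrowIdeal k V) (n : ℕ) :
    ⊤ ≤ Submodule.span k (Set.range fun i => h.toHom (h.dual n i)) := by
  intro φ _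
  have h1 : ∀ i, ∃ c : k, h.eval i φ = toModRad I (c • h.term n i) := by
    intro i
    obtain ⟨y, hy⟩ := Submodule.mkQ_surjective _ (h.eval i φ)
    obtain ⟨y, rfl⟩ := Ideal.Quotient.mk_surjective y
    have h2 : h.eval i φ = toModRad I (y * h.term n i) := by
      have h3 : op (Ideal.Quotient.mk I (h.term n i)) • h.eval i φ = h.eval i φ := by
        refine (map_smul φ.hom _ (fbar I f n i)).symm.trans ?_
        exact congrArg φ.hom (h.fbar_smul_term n i)
      rw [toModRad_smul, ← h3, ← hy]
      rfl
    obtain ⟨c, hc⟩ := mul_vertex_eq_smul_vertex (lengthComponent_mem (k := k) 0 y)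
      (h.uniform n i).terminus
    refine ⟨c, ?_⟩
    rw [h2, term, ← hc, ← sub_eq_zero, ← map_sub, ← sub_mul, toModRad_eq_zero_iff hI]
    exact Ideal.mul_mem_right _ _ (sub_lengthComponent_zero_mem_arrowIdeal y)
  choose c hc using h1
  have h2 : φ = ∑ i, c i • h.toHom (h.dual n i) := h.eval_ext fun i => by
    rw [hc, eval_sum_dual]
  rw [h2]
  exact Submodule.sum_mem _ fun i _ => Submodule.smul_mem _ _ (Submodule.subset_span ⟨i, rfl⟩)

/-- The basis of `Extⁿ(Λ / 𝔯, Λ / 𝔯)` dual to the `fⁿᵢ`. -/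
def extBasis (hI : I ≤ arrowIdeal k V) (n : ℕ) :
    Module.Basis (Fin (s n)) k (Abelian.Ext (modRad I) (modRad I) n) :=
  (Module.Basis.mk (h.linearIndependent_dual hI n) (h.top_le_span_dual hI n)).map (h.extEquiv n)

theorem extBasis_apply (hI : I ≤ arrowIdeal k V) (n : ℕ) (i : Fin (s n)) :
    h.extBasis hI n i = h.extClass (h.dual n i) := by
  rw [extBasis, Module.Basis.map_apply, Module.Basis.mk_apply, extEquiv_toHom]

/-- The maps `liftDual` are an admissible lift of the dual of `fⁿⱼ`, so the product is represented
by `liftDual` followed by the dual of `fᵐᵢ`. This cocycle equals the asserted combination on the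
nose, as a check on generators shows. -/
theorem extProd_dual {c : ∀ r t : ℕ, Fin (s (r + t)) → Fin (s r) → Fin (s t) → k}
    (hc : IsComultiplicative f c) (m n : ℕ) (i : Fin (s m)) (j : Fin (s n)) :
    extProd (h.extClass (h.dual m i)) (h.extClass (h.dual n j)) =
      ∑ l : Fin (s (n + m)), c n m l j i • h.extClass (h.dual (n + m) l) := by
  have hg0 : (ModuleCat.ofHom (h.liftDual hc n 0 j) :
      h.resolution.complex.X (n + 0) ⟶ h.resolution.complex.X 0) ≫ h.resolution.π.f 0 =
      h.toHom (h.dual n j) := by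
    have e1 : h.resolution.π.f 0 = ModuleCat.ofHom (aug I f) :=
      ChainComplex.toSingle₀Equiv_symm_apply_f_zero _ _
    rw [e1]
    exact congrArg ModuleCat.ofHom (h.aug_liftDual hc n j)
  have hg : ∀ r, h.resolution.complex.d (n + (r + 1)) (n + r) ≫
      (ModuleCat.ofHom (h.liftDual hc n r j) :
        h.resolution.complex.X (n + r) ⟶ h.resolution.complex.X r) =
      (ModuleCat.ofHom (h.liftDual hc n (r + 1) j) :
        h.resolution.complex.X (n + (r + 1)) ⟶ h.resolution.complex.X (r + 1)) ≫
        h.resolution.complex.d (r + 1) r := by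
    intro r
    refine (congrArg (· ≫ _) (h.complex_d (n + r))).trans
      (Eq.trans ?_ (congrArg (_ ≫ ·) (h.complex_d r)).symm)
    exact congrArg ModuleCat.ofHom (h.liftDual_diff hc n r j)
  have key := extProd_extMk h.resolution
    (fun r => (ModuleCat.ofHom (h.liftDual hc n r j) :
      h.resolution.complex.X (n + r) ⟶ h.resolution.complex.X r))
    (h.toHom (h.dual n j)) (h.toHom (h.dual m i)) (h.d_comp _ _) (h.d_comp _ _) hg0 hg
    (h.d_comp_comp _ _ _)
  have hsum : h.extEquiv (n + m) (∑ l, c n m l j i • h.toHom (h.dual (n + m) l)) =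
      ∑ l, c n m l j i • h.extClass (h.dual (n + m) l) := by
    rw [map_sum]
    exact Finset.sum_congr rfl fun l _ => map_smul _ _ _
  refine key.trans (Eq.trans ?_ hsum)
  refine congrArg (h.extEquiv (n + m)) (h.eval_ext fun l => ?_)
  rw [eval_sum_dual]
  change h.dual m i (h.liftDual hc n m j (fbar I f (n + m) l)) = _
  rw [liftDual_fbar, map_sum, Finset.sum_eq_single i]
  · rw [LinearMap.map_smul, dual_fbar, if_pos rfl, smul_toModRad, h.smul_term_eq hc]
  · intro i' _ hi'
    rw [LinearMap.map_smul, dual_fbar, if_neg hi'.symm, smul_zero]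
  · exact fun hi => absurd (Finset.mem_univ i) hi

end DefinesMinimalResolution

end KoszulStructure

end

/-! ### The theorem -/

open KoszulStructure in
theorem theorem3p1 {k : Type u} [Field k] {V : Type v} [Quiver.{w} V] [Fintype V]
    [∀ a b : V, Finite (a ⟶ b)]
    (I : Ideal (PathAlgebra k V)) [I.IsTwoSided] (hI : I ≤ arrowIdeal k V ^ 2)
    (hK : IsKoszul I)
    (s : ℕ → ℕ) (f : ∀ n, Fin (s n) → PathAlgebra k V) (hf : DefinesMinimalResolution I f) :
    (∃ c, IsComultiplicative f c) ∧
    (∀ n i, ∃! φ : FTerm I f n →ₗ[(Lam I)ᵐᵒᵖ] ModRad I,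
      ∀ j, φ (fbar I f n j) = if i = j then toModRad I (vertex (hf.uniform n i).terminus) else 0) ∧
    ∀ fhat : ∀ n, Fin (s n) → (FTerm I f n →ₗ[(Lam I)ᵐᵒᵖ] ModRad I),
      (∀ n i j, fhat n i (fbar I f n j) =
        if i = j then toModRad I (vertex (hf.uniform n i).terminus) else 0) →
      (∀ n, ∃ b : Module.Basis (Fin (s n)) k (Abelian.Ext (modRad I) (modRad I) n),
        ∀ i, b i = hf.extClass (fhat n i)) ∧
      ∀ c, IsComultiplicative f c → ∀ (m n : ℕ) (i : Fin (s m)) (j : Fin (s n)),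
        extProd (hf.extClass (fhat m i)) (hf.extClass (fhat n j)) =
          ∑ l : Fin (s (n + m)), c n m l j i • hf.extClass (fhat (n + m) l) := by
  have hI' := hI.trans arrowIdeal_sq_le
  refine ⟨?_, fun n i => ⟨hf.dual n i, hf.dual_fbar n i, fun φ hφ => hf.hom_ext fun j => ?_⟩,
    fun fhat hfhat => ?_⟩
  · obtain ⟨L⟩ := hK.2
    exact hf.exists_isComultiplicative hI (hf.mem_lengthPart L hI')
  · rw [hφ, hf.dual_fbar]
    rfl
  -- A homomorphism on `Fⁿ` is determined by its values at the generators, so the given family is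
  -- the dual one.
  · obtain rfl : fhat = hf.dual := funext fun n => funext fun i => hf.hom_ext fun j => by
      rw [hfhat, hf.dual_fbar]
      rfl
    exact ⟨fun n => ⟨hf.extBasis hI' n, hf.extBasis_apply hI' n⟩,
      fun c hc m n i j => hf.extProd_dual hc m n i j⟩
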